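/- **Setting.** Let $\mathcal K,\mathcal K_\infty$ be the usual classes of comparison functions. A continuous $\beta:\mathbb R_{\ge0}^2\to\mathbb R_{\ge0}$ is of class $\mathcal{KL}$ if $\beta(\cdot,t)\in\mathcal K$ for every $t$ and $\beta(q,\cdot)$ is nonincreasing with limit $0$ for every $q$; $\beta:\mathbb R_{\ge0}^3\to\mathbb R_{\ge0}$ is of class $\mathcal{KLL}$ if $\beta(\cdot,r,\cdot)$ and $\beta(\cdot,\cdot,r)$ are of class $\mathcal{KL}$ for every $r\ge0$. $|\cdot|$ is the Euclidean norm. Consider a plant $\dot x_p=f_p(x_p,\hat u,w)$ and a controller $\dot x_c=f_c(x_c,\hat x_p)$, $u=g_c(x_c,x_p)$. With $x=(x_p,x_c)$, $e=(e_{x_p},e_{x_c})\in\mathbb R^{n_x}$ put $$f(x,e,w)=\begin{pmatrix}f_p(x_p,g_c(x_c+e_{x_c},x_p+e_{x_p}),w)\\ f_c(x_c,x_p+e_{x_p})\end{pmatrix},\qquad g=-f,$$ and assume that $f$ is continuous. For $\Gamma:\mathbb R^{n_x}\times\mathbb R\to\mathbb R$ and $S:\mathbb R\times\mathbb R^{n_x}\to\mathbb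 R$ let $\mathcal H_{STC}$ be the hybrid system with state $\xi=(x,e,\eta,\tau,\tau_{\max})$, $\eta\in\mathbb R$, with flow $\dot\xi=(f(x,e,w),g(x,e,w),0,1,0)$ for $\tau\le\tau_{\max}$ and jumps $\xi^+=(x,0,S(\eta,x),0,\Gamma(x,\eta))$ for $\tau=\tau_{\max}$. Its solutions, for a locally integrable input $w:\mathbb R_{\ge0}\to\mathbb R^{n_w}$, are defined on hybrid time domains, are (locally) absolutely continuous in $t$ between jumps, and satisfy the flow condition for almost all $t$ and the jump condition at every jump. The admissible initial conditions are all $\xi(0,0)$ with $\tau_{\max}(0,0)=\tau(0,0)\ge0$ (so that a sampling takes place at $t_0=0$), and the sampling instant $t_j$ is the time of the jump from $(t_j,j)$ to $(t_j,j+1)$. $\mathcal H_{STC}$ is *ISS* if there are $\beta\in\mathcal{KLL}$ and $\psi\in\mathcal K_\infty$ such that, for all inputs $w$ and all solutions with admissible initial condition, $$|(x,e,\eta)(t,j)|\le\beta\big(|(x,e,\eta)(0,0)|,t,j\big)+\psi(\|w\|_\infty)$$ for all $(t,j)$ in the domain of the solution (no claim if the essential supremum $\|w\|_\infty$ is infinite).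 **Lyapunov condition.** Functions $V:\mathbb R^{n_x}\to\mathbb R_{\ge0}$ (locally Lipschitz) and $\alpha_w\in\mathcal K_\infty$ satisfy the hybrid Lyapunov condition with parameters $\epsilon\in\mathbb R$, $\gamma,L>0$ if there are a locally Lipschitz $W:\mathbb R^{n_x}\to\mathbb R_{\ge0}$, a continuous $H:\mathbb R^{n_x}\times\mathbb R^{n_x}\times\mathbb R^{n_w}\to\mathbb R_{\ge0}$ and $\underline\alpha_W,\overline\alpha_W,\underline\alpha_V,\overline\alpha_V\in\mathcal K_\infty$ with $\underline\alpha_W(|e|)\le W(e)\le\overline\alpha_W(|e|)$ and $\underline\alpha_V(|x|)\le V(x)\le\overline\alpha_V(|x|)$ for all $x,e$; with $\langle\nabla W(e),g(x,e,w)\rangle\le LW(e)+H(x,e,w)$ for all $x,w$ and almost all $e$; and with $\langle\nabla V(x),f(x,e,w)\rangle\le-\epsilon V(x)-H(x,e,w)^2+\gamma^2W(e)^2+\alpha_w(|w|)$ for all $e,w$ and almost all $x$. **Mechanism.** For $\gamma,\Lambda>0$ let $r=\sqrt{|(\gamma/\Lambda)^2-1|}$ and let $T_{\max}(\gamma,\Lambda)$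 be $\frac{\arctan r}{\Lambda r}$ if $\gamma>\Lambda$, $\frac1\Lambda$ if $\gamma=\Lambda$, and $\frac{\operatorname{artanh}r}{\Lambda r}$ if $\gamma<\Lambda$. Let $n_{\mathrm{par}}\ge1$, let $(\epsilon_i,\gamma_i,L_i)$, $1\le i\le n_{\mathrm{par}}$, be parameter sets, and let $\delta\in(0,1)$, $\epsilon_{\mathrm{ref}}>0$. Put $t_{\min}=\delta T_{\max}(\gamma_1,L_1+\frac{\epsilon_1}2)$, $C(x,\eta)=\eta$, and, for $i\ge2$, $\Lambda_i=\max\{L_i+\frac{\epsilon_i}2,1-\delta\}$ and $$\bar h_i(x,\eta)=\begin{cases}\min\Big\{\delta T_{\max}(\gamma_i,\Lambda_i),\dfrac{\log C(x,\eta)-\log V(x)}{\epsilon_{\mathrm{ref}}-\epsilon_i}\Big\}&\text{if }C(x,\eta)\ge V(x)\text{ and }\epsilon_{\mathrm{ref}}-\epsilon_i>0,\\ \delta T_{\max}(\gamma_i,\Lambda_i)&\text{if }C(x,\eta)\ge V(x)\text{ and }\epsilon_{\mathrm{ref}}-\epsilon_i\le0,\\ 0&\text{if }C(x,\eta)<V(x),\end{cases}$$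 where the quotient is read as $+\infty$ if $V(x)=0$. Let $\Gamma(x,\eta)=\max\{t_{\min},\bar h_2(x,\eta),\dots,\bar h_{n_{\mathrm{par}}}(x,\eta)\}$ and $$S(\eta,x)=e^{-\epsilon_{\mathrm{ref}}\Gamma(x,\eta)}\,(r_1\eta+r_2V(x)).$$ **Theorem 2.** Assume that $V$ and $\alpha_w$ satisfy the hybrid Lyapunov condition with each of the parameter sets $(\epsilon_i,\gamma_i,L_i)$, $i=1,\dots,n_{\mathrm{par}}$ (where $W$, $H$ and the comparison functions bounding $V$ and $W$ may depend on $i$), that $\epsilon_1,r_1,r_2>0$ and that $r_1+r_2\le1$. Consider $\mathcal H_{STC}$ with the above $\Gamma$ and $S$. Then $t_{\min}>0$, consecutive sampling instants of every solution with admissible initial condition satisfy $t_{j+1}-t_j\ge t_{\min}$, and $\mathcal H_{STC}$ is ISS. -/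

import Mathlib

open scoped NNReal

noncomputable section

namespace STC

/-! ### Comparison functions -/

/-- Class `𝒦`: continuous, strictly increasing, zero at zero. -/
structure IsClassK (α : ℝ≥0 → ℝ≥0) : Prop where
  continuous : Continuous α
  strictMono : StrictMono α
  zero : α 0 = 0

/-- Class `𝒦_∞`: class `𝒦` and unbounded. -/
structure IsClassKInf (α : ℝ≥0 → ℝ≥0) : Prop extends IsClassK α where
  unbounded : ¬ BddAbove (Set.range α)

/-- Class `𝒦ℒ`. -/
structure IsClassKL (β : ℝ≥0 → ℝ≥0 → ℝ≥0) : Prop where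
  continuous : Continuous fun p : ℝ≥0 × ℝ≥0 => β p.1 p.2
  classK : ∀ t, IsClassK fun q => β q t
  antitone : ∀ q, Antitone (β q)
  tendsto : ∀ q, Filter.Tendsto (β q) Filter.atTop (nhds 0)

/-- Class `𝒦ℒℒ`. -/
structure IsClassKLL (β : ℝ≥0 → ℝ≥0 → ℝ≥0 → ℝ≥0) : Prop where
  left : ∀ r, IsClassKL fun q t => β q r t
  right : ∀ r, IsClassKL fun q t => β q t r

/-! ### Hybrid systems -/

/-- Compact hybrid time domains `⋃_{j < J} [t_j, t_{j+1}] × {j}` with `0 = t_0 ≤ t_1 ≤ … ≤ t_J`. -/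
def IsCompactHybridTimeDomain (D : Set (ℝ × ℕ)) : Prop :=
  ∃ (J : ℕ) (t : ℕ → ℝ), t 0 = 0 ∧ (∀ j < J, t j ≤ t (j + 1)) ∧
    D = {p | p.2 < J ∧ p.1 ∈ Set.Icc (t p.2) (t (p.2 + 1))}

/-- Hybrid time domains: subsets of `ℝ_{≥0} × ℕ₀` whose truncations are compact hybrid time
domains. -/
def IsHybridTimeDomain (D : Set (ℝ × ℕ)) : Prop :=
  (∀ p ∈ D, 0 ≤ p.1) ∧
    ∀ T J, (T, J) ∈ D → IsCompactHybridTimeDomain (D ∩ Set.Icc 0 T ×ˢ Set.Iic J)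

/-- The data `(F, G, C, D)` of a hybrid system with state space `Ξ` and input space `W`. -/
structure HybridSystem (Ξ W : Type*) where
  F : Ξ → W → Ξ
  G : Ξ → Ξ
  C : Set Ξ
  D : Set Ξ

/-- The section `I_j = {t | (t, j) ∈ dom}`. -/
def section_ (dom : Set (ℝ × ℕ)) (j : ℕ) : Set ℝ := {t | (t, j) ∈ dom}

/-- `(dom, ξ)` is a solution of the hybrid system `S` for the locally integrable input `w`; only
the values of `ξ` on `dom` and of `w` on `[0, ∞)` matter. -/
structure HybridSystem.IsSolution {Ξ W : Type*} [NormedAddCommGroup Ξ] [NormedSpace ℝ Ξ]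
    [NormedAddCommGroup W] (S : HybridSystem Ξ W) (w : ℝ → W) (dom : Set (ℝ × ℕ))
    (ξ : ℝ → ℕ → Ξ) : Prop where
  input : MeasureTheory.LocallyIntegrableOn w (Set.Ici 0)
  domain : IsHybridTimeDomain dom
  absCont : ∀ j, ∀ a ∈ section_ dom j, ∀ b ∈ section_ dom j,
    AbsolutelyContinuousOnInterval (fun t => ξ t j) a b
  flow : ∀ j, ∀ᵐ t : ℝ, t ∈ section_ dom j →
    ξ t j ∈ S.C ∧ HasDerivWithinAt (fun s => ξ s j) (S.F (ξ t j) (w t)) (section_ dom j) t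
  jump : ∀ t j, (t, j) ∈ dom → (t, j + 1) ∈ dom → ξ t j ∈ S.D ∧ ξ t (j + 1) = S.G (ξ t j)

/-! ### The sampled-data loop -/

/-- `ℝⁿ` with the Euclidean norm. -/
abbrev Vec (n : ℕ) := EuclideanSpace ℝ (Fin n)

/-- `ℝ^{n_p + n_c}` with the Euclidean norm, the space of stacked vectors `(x_p, x_c)`. -/
abbrev Stacked (np nc : ℕ) := EuclideanSpace ℝ (Fin np ⊕ Fin nc)

def stack {np nc : ℕ} (a : Vec np) (b : Vec nc) : Stacked np nc :=
  WithLp.toLp 2 (Sum.elim (fun i => a i) (fun i => b i))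

def plantPart {np nc : ℕ} (x : Stacked np nc) : Vec np := WithLp.toLp 2 fun i => x (Sum.inl i)

def ctrlPart {np nc : ℕ} (x : Stacked np nc) : Vec nc := WithLp.toLp 2 fun i => x (Sum.inr i)

/-- Plant `ẋ_p = f_p(x_p, û, w)` and controller `ẋ_c = f_c(x_c, x̂_p)`, `u = g_c(x_c, x_p)`. -/
structure Loop (np nc nu nw : ℕ) where
  fp : Vec np → Vec nu → Vec nw → Vec np
  fc : Vec nc → Vec np → Vec nc
  gc : Vec nc → Vec np → Vec nu

/-- The flow of `x = (x_p, x_c)` under the sampling-induced error `e = (x̂_p - x_p, x̂_c - x_c)`. -/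
def Loop.f {np nc nu nw : ℕ} (P : Loop np nc nu nw) (x e : Stacked np nc) (w : Vec nw) :
    Stacked np nc :=
  stack
    (P.fp (plantPart x) (P.gc (ctrlPart x + ctrlPart e) (plantPart x + plantPart e)) w)
    (P.fc (ctrlPart x) (plantPart x + plantPart e))

/-- The flow `g = -f` of the sampling-induced error. -/
def Loop.g {np nc nu nw : ℕ} (P : Loop np nc nu nw) (x e : Stacked np nc) (w : Vec nw) :
    Stacked np nc :=
  -P.f x e w

/-- States `ξ = (x, e, η, τ, τ_max)` of the closed loop; `N` is the space of the dynamic variable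
`η`. The norm of this product is used only through its topology. -/
abbrev State (np nc : ℕ) (N : Type*) := Stacked np nc × Stacked np nc × N × ℝ × ℝ

namespace State

variable {np nc : ℕ} {N : Type*}

def x (ξ : State np nc N) : Stacked np nc := ξ.1
def e (ξ : State np nc N) : Stacked np nc := ξ.2.1
def η (ξ : State np nc N) : N := ξ.2.2.1
def τ (ξ : State np nc N) : ℝ := ξ.2.2.2.1
def τmax (ξ : State np nc N) : ℝ := ξ.2.2.2.2

/-- The Euclidean norm of the vector `(x, e, η)`. -/
def size [NormedAddCommGroup N] (ξ : State np nc N) : ℝ≥0 :=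
  NNReal.sqrt (‖ξ.x‖₊ ^ 2 + ‖ξ.e‖₊ ^ 2 + ‖ξ.η‖₊ ^ 2)

/-- The admissible initial conditions: `x`, `e`, `η` arbitrary and `τ_max = τ ≥ 0`. -/
def IsInitial (ξ : State np nc N) : Prop := 0 ≤ ξ.τ ∧ ξ.τmax = ξ.τ

end State

/-- The hybrid system `H_STC` for the sampling map `Γ` and the update `S` of the dynamic
variable. -/
def closedLoop {np nc nu nw : ℕ} {N : Type*} [NormedAddCommGroup N] (P : Loop np nc nu nw)
    (Γ : Stacked np nc → N → ℝ) (S : N → Stacked np nc → N) :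
    HybridSystem (State np nc N) (Vec nw) where
  F ξ w := (P.f ξ.x ξ.e w, P.g ξ.x ξ.e w, 0, 1, 0)
  G ξ := (ξ.x, 0, S ξ.η ξ.x, 0, Γ ξ.x ξ.η)
  C := {ξ | ξ.τ ≤ ξ.τmax}
  D := {ξ | ξ.τ = ξ.τmax}

/-- The essential supremum `‖w‖_∞` of `|w|` over `[0, ∞)`, possibly `∞`. -/
def supNorm {nw : ℕ} (w : ℝ → Vec nw) : ENNReal :=
  MeasureTheory.eLpNormEssSup w (MeasureTheory.volume.restrict (Set.Ici 0))

/-- Input-to-state stability of a hybrid system with states `(x, e, η, τ, τ_max)`. For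
`‖w‖_∞ = ∞` the estimate says nothing. -/
def IsISS {np nc nw : ℕ} {N : Type*} [NormedAddCommGroup N] [NormedSpace ℝ N]
    (H : HybridSystem (State np nc N) (Vec nw)) : Prop :=
  ∃ (β : ℝ≥0 → ℝ≥0 → ℝ≥0 → ℝ≥0) (ψ : ℝ≥0 → ℝ≥0), IsClassKLL β ∧ IsClassKInf ψ ∧
    ∀ (w : ℝ → Vec nw) (dom : Set (ℝ × ℕ)) (ξ : ℝ → ℕ → State np nc N),
      H.IsSolution w dom ξ → (ξ 0 0).IsInitial → supNorm w ≠ ⊤ →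
      ∀ t j, (t, j) ∈ dom →
        (ξ t j).size ≤ β (ξ 0 0).size t.toNNReal j + ψ (supNorm w).toNNReal

/-- `t` is the time of the `j`-th jump, that is, the sampling instant `t_j`. -/
def IsSamplingInstant (dom : Set (ℝ × ℕ)) (j : ℕ) (t : ℝ) : Prop :=
  (t, j) ∈ dom ∧ (t, j + 1) ∈ dom

/-- Along every solution with an admissible initial condition, consecutive sampling instants
satisfy `t_{j+1} - t_j ≥ c`. -/
def InterSamplingAtLeast {np nc nw : ℕ} {N : Type*} [NormedAddCommGroup N] [NormedSpace ℝ N]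
    (H : HybridSystem (State np nc N) (Vec nw)) (c : ℝ) : Prop :=
  ∀ (w : ℝ → Vec nw) (dom : Set (ℝ × ℕ)) (ξ : ℝ → ℕ → State np nc N),
    H.IsSolution w dom ξ → (ξ 0 0).IsInitial →
    ∀ (j : ℕ) (t t' : ℝ), IsSamplingInstant dom j t → IsSamplingInstant dom (j + 1) t' →
      c ≤ t' - t

/-! ### Hybrid Lyapunov functions -/

/-- The hybrid Lyapunov condition for the loop `P`, with the functions `V`, `α_w` and the
parameters `ε`, `γ`, `L`; the functions `W`, `H` and the comparison functions are existential. -/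
def HybridLyapunov {np nc nu nw : ℕ} (P : Loop np nc nu nw) (V : Stacked np nc → ℝ)
    (αw : ℝ≥0 → ℝ≥0) (ε γ L : ℝ) : Prop :=
  0 < γ ∧ 0 < L ∧ LocallyLipschitz V ∧ (∀ x, 0 ≤ V x) ∧ IsClassKInf αw ∧
  ∃ (W : Stacked np nc → ℝ) (H : Stacked np nc → Stacked np nc → Vec nw → ℝ)
    (αWlo αWhi αVlo αVhi : ℝ≥0 → ℝ≥0),
    LocallyLipschitz W ∧ (∀ e, 0 ≤ W e) ∧
    Continuous (fun z : Stacked np nc × Stacked np nc × Vec nw => H z.1 z.2.1 z.2.2) ∧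
    (∀ x e w, 0 ≤ H x e w) ∧
    IsClassKInf αWlo ∧ IsClassKInf αWhi ∧ IsClassKInf αVlo ∧ IsClassKInf αVhi ∧
    (∀ e, αWlo ‖e‖₊ ≤ W e ∧ W e ≤ αWhi ‖e‖₊) ∧
    (∀ x, αVlo ‖x‖₊ ≤ V x ∧ V x ≤ αVhi ‖x‖₊) ∧
    (∀ x w, ∀ᵐ e : Stacked np nc, inner ℝ (gradient W e) (P.g x e w) ≤ L * W e + H x e w) ∧
    (∀ e w, ∀ᵐ x : Stacked np nc, inner ℝ (gradient V x) (P.f x e w) ≤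
      -ε * V x - H x e w ^ 2 + γ ^ 2 * W e ^ 2 + αw ‖w‖₊)

/-! ### The self-triggered sampling mechanism -/

/-- The number `r` in the definition of `T_max`. -/
def rConst (γ Λ : ℝ) : ℝ := √|(γ / Λ) ^ 2 - 1|

/-- The bound `T_max(γ, Λ)` on the sampling interval, for `γ, Λ > 0`. -/
def Tmax (γ Λ : ℝ) : ℝ :=
  if Λ < γ then 1 / (Λ * rConst γ Λ) * Real.arctan (rConst γ Λ)
  else if γ = Λ then 1 / Λ
  else 1 / (Λ * rConst γ Λ) * Real.artanh (rConst γ Λ)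

/-- The candidate interval `h_i` for one parameter set `(ε, γ, L)`, where `v = V(x)` and
`c = C(x, η)`. For `v = 0` the quotient of logarithms is `∞`, and the minimum is its first
argument. -/
def candidate (δ εref ε γ L v c : ℝ) : ℝ :=
  if v ≤ c then
    if 0 < -ε + εref ∧ v ≠ 0 then
      min (δ * Tmax γ (max (L + ε / 2) (1 - δ))) ((Real.log c - Real.log v) / (-ε + εref))
    else δ * Tmax γ (max (L + ε / 2) (1 - δ))
  else 0

/-- The fall-back interval `t_min = δ T_max(γ₁, L₁ + ε₁ / 2)`. -/
def tmin (δ ε₁ γ₁ L₁ : ℝ) : ℝ := δ * Tmax γ₁ (L₁ + ε₁ / 2)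

/-- The sampling map `Γ` computed by the algorithm from `v = V(x)` and `c = C(x, η)`. There are
`n_par = n + 1` parameter sets; index `0` is the set of the fall-back strategy. -/
def sampling {n : ℕ} (δ εref : ℝ) (ε γ L : Fin (n + 1) → ℝ) (v c : ℝ) : ℝ :=
  (List.finRange n).foldl
    (fun h i =>
      let hi := candidate δ εref (ε i.succ) (γ i.succ) (L i.succ) v c
      if h < hi then hi else h)
    (tmin δ (ε 0) (γ 0) (L 0))

/-- The sampling map of the IIR mechanism, with scalar dynamic variable and `C(x, η) = η`. -/
def iirΓ {np nc n : ℕ} (V : Stacked np nc → ℝ) (δ εref : ℝ) (ε γ L : Fin (n + 1) → ℝ)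
    (x : Stacked np nc) (η : ℝ) : ℝ :=
  sampling δ εref ε γ L (V x) η

/-- The update `e^{-ε_ref Γ(x, η)} (r₁ η + r₂ V(x))` of the IIR mechanism. -/
def iirS {np nc n : ℕ} (V : Stacked np nc → ℝ) (δ εref r₁ r₂ : ℝ) (ε γ L : Fin (n + 1) → ℝ)
    (η : ℝ) (x : Stacked np nc) : ℝ :=
  Real.exp (-εref * iirΓ V δ εref ε γ L x η) * (r₁ * η + r₂ * V x)

end STC

end

open scoped NNReal Topology

section

open Set Filter MeasureTheory

/-! ### Absolutely continuous functions: composition and derivative bounds -/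

namespace AbsolutelyContinuousOnInterval

/-! Between samplings, `V` is controlled through `U = V(x) + γ φ(τ) W(e)²`, where `φ ≥ 0` solves the
Riccati equation `φ' = -2Λφ - γ(1 + φ²)` with `Λ ≥ L + ε/2`. Completing the square in `H` gives `U'
≤ -ε U + α_w(|w|)`. A sampling resets `e` to `0`, so `U` starts at `V` and dominates it afterwards
(`HybridLyapunov.le_of_flow`). Such a `φ` exists on `[0, δ T_max(γ, Λ)]` (`exists_riccati`,
`exists_weight`).

As `V` and `W` are only locally Lipschitz and their gradient inequalities hold almost everywhere, a
solution may run inside the exceptional null set. Fubini and continuity carry the inequality to all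
segments, and comparison with the tangent carries it to curves
(`LocallyLipschitz.hasDerivAt_comp_le`).

The quantity that decays from sampling to sampling is `N = max(V(x), |η|)`. After a fall-back
interval `V` has decayed at the positive rate of the first parameter set. Any other interval is
short enough that `exp(-ε_i t) V ≤ exp(-ε_ref t) η` throughout, even if `ε_i` is negative. The
update of `η` contracts because `r₁ + r₂ ≤ 1`. Hence `N` decays at rate `min(ε₁, ε_ref)` up to a
bounded gain of the input (`stepDecay_iir`). Since intervals last at least `t_min`, the gains sum to
a geometric series and decay in `t` yields decay in `j`; `e` is a difference of two values of `x`,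
so bounding `N` suffices (`StepDecay.isISS`). -/

theorem lipschitzOnWith_comp {X Y : Type*} [PseudoMetricSpace X] [PseudoMetricSpace Y]
    {f : ℝ → X} {g : X → Y} {s : Set X} {K : ℝ≥0} {a b : ℝ}
    (hf : AbsolutelyContinuousOnInterval f a b) (hg : LipschitzOnWith K g s)
    (hs : MapsTo f (uIcc a b) s) : AbsolutelyContinuousOnInterval (fun t => g (f t)) a b := by
  apply squeeze_zero' ?_ ?_ (by simpa using Tendsto.const_mul (K : ℝ) hf)
  · exact Filter.Eventually.of_forall fun _ => Finset.sum_nonneg fun i hi => dist_nonneg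
  rw [eventually_inf_principal]
  filter_upwards with (n, I) hnI
  rw [Finset.mul_sum]
  simp only [disjWithin, mem_ofPred_eq] at hnI
  exact Finset.sum_le_sum fun i hi =>
    hg.dist_le_mul _ (hs (hnI.1 i hi).1) _ (hs (hnI.1 i hi).2)

theorem lipschitzWith_comp {X Y : Type*} [PseudoMetricSpace X] [PseudoMetricSpace Y]
    {f : ℝ → X} {g : X → Y} {K : ℝ≥0} {a b : ℝ}
    (hf : AbsolutelyContinuousOnInterval f a b) (hg : LipschitzWith K g) :
    AbsolutelyContinuousOnInterval (fun t => g (f t)) a b :=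
  hf.lipschitzOnWith_comp (hg.lipschitzOnWith (s := univ)) (mapsTo_univ _ _)

theorem locallyLipschitz_comp {X Y : Type*} [SeminormedAddCommGroup X] [PseudoMetricSpace Y]
    {f : ℝ → X} {g : X → Y} {a b : ℝ}
    (hf : AbsolutelyContinuousOnInterval f a b) (hg : LocallyLipschitz g) :
    AbsolutelyContinuousOnInterval (fun t => g (f t)) a b := by
  have hc : IsCompact (f '' uIcc a b) := isCompact_Icc.image_of_continuousOn hf.continuousOn
  obtain ⟨K, hK⟩ := LocallyLipschitzOn.exists_lipschitzOnWith_of_compact hc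
    (hg.locallyLipschitzOn)
  exact hf.lipschitzOnWith_comp hK (mapsTo_image f (uIcc a b))

/-- The fundamental theorem of calculus for absolutely continuous functions. Differentiability
almost everywhere is automatic, so the bound is only asked of derivatives that exist. -/
theorem sub_le_of_hasDerivAt_le {f : ℝ → ℝ} {a b M : ℝ} (hab : a ≤ b)
    (hf : AbsolutelyContinuousOnInterval f a b)
    (h : ∀ᵐ t, t ∈ Ioo a b → ∀ d, HasDerivAt f d t → d ≤ M) : f b - f a ≤ M * (b - a) := by
  rw [← hf.integral_deriv_eq_sub, mul_comm, ← smul_eq_mul, ← intervalIntegral.integral_const]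
  refine intervalIntegral.integral_mono_ae_restrict hab hf.intervalIntegrable_deriv
    intervalIntegrable_const ?_
  rw [EventuallyLE, ← Measure.restrict_congr_set (Ioo_ae_eq_Icc (μ := volume)),
    ae_restrict_iff' measurableSet_Ioo]
  filter_upwards [h, hf.ae_differentiableAt] with t ht hd hm
  exact ht hm _ (hd (by rw [uIcc_of_le hab]; exact Ioo_subset_Icc_self hm)).hasDerivAt

theorem eq_of_hasDerivAt_const {f : ℝ → ℝ} {a b c : ℝ} (hab : a ≤ b)
    (hf : AbsolutelyContinuousOnInterval f a b)
    (h : ∀ᵐ t, t ∈ Ioo a b → HasDerivAt f c t) : f b - f a = c * (b - a) := by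
  apply le_antisymm
  · exact hf.sub_le_of_hasDerivAt_le hab
      (h.mono fun t ht hm d hd => (hd.unique (ht hm)).le)
  · have := hf.fun_neg.sub_le_of_hasDerivAt_le (M := -c) hab
      (h.mono fun t ht hm d hd => (hd.unique (ht hm).neg).le)
    linarith

end AbsolutelyContinuousOnInterval

/-! ### Chain rule for locally Lipschitz functions with almost everywhere gradient bounds -/

section DirectionalBound

theorem norm_gradient_le_of_lipschitzOnWith {E : Type*} [NormedAddCommGroup E]
    [InnerProductSpace ℝ E] [CompleteSpace E] {F : E → ℝ} {K : ℝ≥0} {U : Set E} (hU : IsOpen U)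
    (hF : LipschitzOnWith K F U) {y : E} (hy : y ∈ U) : ‖gradient F y‖ ≤ K := by
  rw [gradient, LinearIsometryEquiv.norm_map]
  exact norm_fderiv_le_of_lipschitzOn ℝ (hU.mem_nhds hy) hF

variable {E : Type*} [NormedAddCommGroup E] [InnerProductSpace ℝ E] [FiniteDimensional ℝ E]
  [MeasurableSpace E] [BorelSpace E] {F : E → ℝ}

/-- An almost everywhere bound on a directional derivative of a Lipschitz function integrates
along every segment in that direction. -/
theorem LipschitzOnWith.sub_le_of_ae_inner_gradient_le {K : ℝ≥0} {U : Set E} (hU : IsOpen U)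
    (hF : LipschitzOnWith K F U) {v : E} {M : ℝ}
    (hM : ∀ᵐ y : E, y ∈ U → inner ℝ (gradient F y) v ≤ M) {y : E} {h : ℝ} (hh : 0 ≤ h)
    (hseg : ∀ s ∈ Icc 0 h, y + s • v ∈ U) : F (y + h • v) - F y ≤ M * h := by
  have hgood : ∀ᵐ z : E, z ∈ U → DifferentiableAt ℝ F z ∧ inner ℝ (gradient F z) v ≤ M := by
    filter_upwards [hM, hF.ae_differentiableWithinAt_of_mem (μ := volume)] with z h1 h2 hz
    exact ⟨(h2 hz).differentiableAt (hU.mem_nhds hz), h1 hz⟩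
  obtain ⟨N, hN, hNm, hN0⟩ := exists_measurable_superset_of_null hgood
  -- Fubini: almost every line in direction `v` meets the null set `N` in a null set of parameters.
  have hline : ∀ᵐ z : E, ∀ᵐ s : ℝ, z + s • v ∈ Nᶜ := by
    have := (ae_ae_add_linearMap_mem_iff (𝕜 := ℝ) (LinearMap.toSpanSingleton ℝ E v)
      (volume : Measure ℝ) (volume : Measure E) hNm.compl).2
      (by rw [ae_iff]; simpa using hN0)
    simpa using this
  have hcont : ContinuousOn F U := hF.continuousOn
  -- the estimate for almost every starting point
  have hae : ∀ᵐ z : E, (∀ s ∈ Icc 0 h, z + s • v ∈ U) → F (z + h • v) - F z ≤ M * h := by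
    filter_upwards [hline] with z hz hseg
    have hlip : LipschitzWith ‖v‖₊ fun s : ℝ => z + s • v :=
      LipschitzWith.of_dist_le_mul fun s t => by
        rw [dist_add_left, dist_eq_norm, ← sub_smul, norm_smul, mul_comm, Real.dist_eq,
          Real.norm_eq_abs, coe_nnnorm]
    have hac : AbsolutelyContinuousOnInterval (fun s : ℝ => F (z + s • v)) 0 h := by
      have h1 : AbsolutelyContinuousOnInterval (fun s : ℝ => z + s • v) 0 h :=
        (hlip.lipschitzOnWith (s := uIcc 0 h)).absolutelyContinuousOnInterval
      exact h1.lipschitzOnWith_comp hF fun s hs => hseg s (by rwa [uIcc_of_le hh] at hs)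
    have := hac.sub_le_of_hasDerivAt_le (M := M) hh (by
      filter_upwards [hz] with s hs hm d hd
      have hgd := of_not_not fun hc => hs (hN hc)
      obtain ⟨hdiff, hle⟩ := hgd (hseg s (Ioo_subset_Icc_self hm))
      have hl : HasDerivAt (fun s : ℝ => z + s • v) v s := by
        simpa using ((hasDerivAt_id s).smul_const v).const_add z
      have hc := hdiff.hasGradientAt.hasFDerivAt.comp_hasDerivAt s hl
      have := hd.unique hc
      rw [this]
      simpa using hle)
    simpa using this
  -- the starting points for which the estimate is known accumulate at `y`
  have hopen : ∀ᶠ z in 𝓝 y, ∀ s ∈ Icc 0 h, z + s • v ∈ U := by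
    refine isCompact_Icc.eventually_forall_of_forall_eventually fun s hs => ?_
    have : Continuous fun p : E × ℝ => p.1 + p.2 • v := by fun_prop
    exact this.continuousAt.eventually (hU.mem_nhds (hseg s hs))
  have hfreq : ∃ᶠ z in 𝓝 y, F (z + h • v) - F z ≤ M * h := by
    have hd : Dense {z : E | (∀ s ∈ Icc 0 h, z + s • v ∈ U) → F (z + h • v) - F z ≤ M * h} :=
      Measure.dense_of_ae hae
    exact ((mem_closure_iff_frequently.1 (hd y)).and_eventually hopen).mono
      fun z hz => hz.1 hz.2
  have c1 : ContinuousAt F y :=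
    hcont.continuousAt (hU.mem_nhds (by simpa using hseg 0 ⟨le_rfl, hh⟩))
  have c2 : ContinuousAt (fun z => F (z + h • v)) y :=
    ContinuousAt.comp (f := fun z => z + h • v)
      (hcont.continuousAt (hU.mem_nhds (hseg h ⟨hh, le_rfl⟩))) (by fun_prop)
  by_contra! hlt
  exact hfreq ((((c2.sub c1).eventually (lt_mem_nhds hlt))).mono fun z hz => not_le.2 hz)

/-- Chain rule inequality along a curve for a locally Lipschitz function whose gradient satisfies
a differential inequality almost everywhere. -/
theorem LocallyLipschitz.hasDerivAt_comp_le (hF : LocallyLipschitz F) {G : E → E} {B : E → ℝ}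
    (hae : ∀ᵐ y : E, inner ℝ (gradient F y) (G y) ≤ B y) {c : ℝ → E} {t d : ℝ}
    (hG : ContinuousAt G (c t)) (hB : ContinuousAt B (c t)) (hc : HasDerivAt c (G (c t)) t)
    (hd : HasDerivAt (fun s => F (c s)) d t) : d ≤ B (c t) := by
  set x := c t with hx
  set v := G x with hv
  obtain ⟨K, T, hT, hK⟩ := hF x
  refine le_of_forall_pos_le_add fun r hr => ?_
  -- Half of the slack `r` pays for replacing `G y` by the fixed direction `v`, as the gradient is
  -- bounded by `K`; the other half pays for replacing `B y` by `B x`. `K + 1` guards against `K =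
  -- 0`.
  have hloc : ∀ᶠ y in 𝓝 x, y ∈ T ∧ ‖G y - v‖ < r / (2 * (K + 1)) ∧ B y < B x + r / 2 := by
    refine (eventually_mem_set.2 hT).and (Eventually.and ?_ ?_)
    · have := hG.eventually (Metric.ball_mem_nhds _ (show 0 < r / (2 * ((K : ℝ) + 1)) by positivity))
      exact this.mono fun y hy => by simpa [dist_eq_norm] using hy
    · exact hB.eventually (gt_mem_nhds (by linarith))
  obtain ⟨U, hUsub, hU, hxU⟩ := _root_.mem_nhds_iff.1 hloc
  have hKU : LipschitzOnWith K F U := hK.mono fun y hy => (hUsub hy).1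
  have hM : ∀ᵐ y : E, y ∈ U → inner ℝ (gradient F y) v ≤ B x + r := by
    filter_upwards [hae] with y hy hyU
    obtain ⟨-, h1, h2⟩ := hUsub hyU
    have h3 : inner ℝ (gradient F y) v
        = inner ℝ (gradient F y) (G y) - inner ℝ (gradient F y) (G y - v) := by
      rw [inner_sub_right]; ring
    have h4 : |inner ℝ (gradient F y) (G y - v)| ≤ r / 2 := by
      refine (abs_real_inner_le_norm _ _).trans ?_
      have h5 := norm_gradient_le_of_lipschitzOnWith hU hKU hyU
      calc ‖gradient F y‖ * ‖G y - v‖ ≤ (K + 1) * (r / (2 * (K + 1))) := by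
            gcongr; linarith
        _ = r / 2 := by field_simp
    rw [h3]
    linarith [neg_abs_le (inner ℝ (gradient F y) (G y - v))]
  -- compare the curve with its tangent
  have hl : HasDerivAt (fun s : ℝ => x + (s - t) • v) v t := by
    simpa using (((hasDerivAt_id t).sub_const t).smul_const v).const_add x
  have hdiff : (fun s => c s - (x + (s - t) • v)) =o[𝓝 t] fun s => s - t := by
    have := (hc.sub hl).isLittleO
    simpa [← hx] using this
  have hcU : ∀ᶠ s in 𝓝 t, c s ∈ U := hc.continuousAt.eventually (hU.mem_nhds hxU)
  have hlU : ∀ᶠ s in 𝓝 t, x + (s - t) • v ∈ U :=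
    hl.continuousAt.eventually (by simpa using hU.mem_nhds hxU)
  -- Since `F` is Lipschitz near `x`, it inherits the tangency, so `d` is also the derivative of `F`
  -- along the tangent line.
  have hFdiff : (fun s => F (c s) - F (x + (s - t) • v)) =o[𝓝 t] fun s => s - t := by
    refine Asymptotics.IsBigO.trans_isLittleO (Asymptotics.IsBigO.of_bound K ?_) hdiff
    filter_upwards [hcU, hlU] with s h1 h2
    simpa [dist_eq_norm] using hKU.dist_le_mul _ h1 _ h2
  have hderiv : HasDerivAt (fun s => F (x + (s - t) • v)) d t := by
    have h1 : HasDerivAt (fun s => F (c s) - F (x + (s - t) • v)) 0 t := by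
      rw [hasDerivAt_iff_isLittleO]
      simpa [← hx] using hFdiff
    have := hd.fun_sub h1
    simpa only [sub_sub_cancel, sub_zero] using this
  -- Right slopes suffice, and the segment estimate bounds each of them by `B x + r`.
  have hslope := (hasDerivAt_iff_tendsto_slope.1 hderiv).mono_left
    (nhdsWithin_mono t (fun s (hs : s ∈ Ioi t) => ne_of_gt hs))
  refine le_of_tendsto hslope ?_
  obtain ⟨ρ, hρ, hball⟩ := Metric.eventually_nhds_iff.1 hlU
  filter_upwards [Ioo_mem_nhdsGT (show t < t + ρ by linarith)] with s hs
  have hst : 0 < s - t := by linarith [hs.1]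
  rw [slope_def_field, div_le_iff₀ hst]
  have := hKU.sub_le_of_ae_inner_gradient_le hU hM (y := x) hst.le fun q hq => by
    have := @hball (t + q) (by
      rw [Real.dist_eq, add_sub_cancel_left, abs_of_nonneg hq.1]; linarith [hq.2, hs.2])
    simpa using this
  simpa using this

end DirectionalBound

/-! ### Riccati equation and growth of `V` between samplings -/

namespace STC

/-- A nonnegative solution of the Riccati equation `ψ' = Λ² - γ² - ψ²` that stays above `Λ` up to
time `T_max(γ, Λ)`. -/
theorem exists_riccati {γ Λ : ℝ} (hγ : 0 < γ) (hΛ : 0 < Λ) :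
    0 < Tmax γ Λ ∧ ∃ ψ : ℝ → ℝ, ∀ t ∈ Ioc 0 (Tmax γ Λ),
      Λ ≤ ψ t ∧ HasDerivAt ψ (Λ ^ 2 - γ ^ 2 - ψ t ^ 2) t := by
  have hlin : ∀ ω t : ℝ, HasDerivAt (fun s => ω * s) ω t := fun ω t => by
    simpa using (hasDerivAt_id t).const_mul ω
  rcases lt_trichotomy Λ γ with h | h | h
  · have hq : 0 < (γ / Λ) ^ 2 - 1 := by
      have : 1 < γ / Λ := (one_lt_div hΛ).2 h
      nlinarith
    set r := rConst γ Λ with hr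
    have hr0 : 0 < r := by rw [hr, rConst]; exact Real.sqrt_pos.2 (abs_pos.2 hq.ne')
    have hr2 : r ^ 2 = (γ / Λ) ^ 2 - 1 := by
      rw [hr, rConst, Real.sq_sqrt (abs_nonneg _), abs_of_pos hq]
    set ω := Λ * r with hω
    have hω0 : 0 < ω := mul_pos hΛ hr0
    have hω2 : ω ^ 2 = γ ^ 2 - Λ ^ 2 := by
      rw [hω, mul_pow, hr2]; field_simp
    have hT : Tmax γ Λ = 1 / ω * Real.arctan r := by rw [Tmax, if_pos h]
    have ha : 0 < Real.arctan r := by simpa using Real.arctan_strictMono hr0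
    -- With `ω² = γ² - Λ²`, the solution with a pole at `0` is `ω cot(ωt)`. It stays above `Λ` as
    -- long as `tan(ωt) ≤ r`, which is where the formula for `T_max` comes from. The other two cases
    -- use `1/t` and `ω coth(ωt)`.
    refine ⟨by rw [hT]; positivity, fun t => ω * (Real.cos (ω * t) / Real.sin (ω * t)), ?_⟩
    intro t ht
    have h1 : 0 < ω * t := mul_pos hω0 ht.1
    have h2 : ω * t ≤ Real.arctan r := by
      have := ht.2
      rw [hT, one_div, ← div_eq_inv_mul, le_div_iff₀ hω0] at this
      linarith
    have h3 : ω * t < Real.pi / 2 := h2.trans_lt (Real.arctan_lt_pi_div_two r)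
    have hs : 0 < Real.sin (ω * t) := Real.sin_pos_of_pos_of_lt_pi h1 (by linarith [Real.pi_pos])
    have hc : 0 < Real.cos (ω * t) := Real.cos_pos_of_mem_Ioo ⟨by linarith, h3⟩
    have htan : Real.sin (ω * t) ≤ r * Real.cos (ω * t) := by
      rw [← div_le_iff₀ hc, ← Real.tan_eq_sin_div_cos, ← Real.arctan_le_arctan_iff,
        Real.arctan_tan (by linarith) h3]
      exact h2
    constructor
    · beta_reduce
      rw [mul_div_assoc', le_div_iff₀ hs]
      refine (mul_le_mul_of_nonneg_left htan hΛ.le).trans_eq ?_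
      linear_combination (-Real.cos (ω * t)) * hω
    · have hd := (((hlin ω t).cos.fun_div (hlin ω t).sin hs.ne').const_mul ω)
      refine hd.congr_deriv ?_
      beta_reduce
      have := Real.sin_sq_add_cos_sq (ω * t)
      field_simp
      linear_combination (-Real.sin (ω * t) ^ 2) * hω2
  · subst h
    have hT : Tmax Λ Λ = 1 / Λ := by rw [Tmax, if_neg (lt_irrefl _), if_pos rfl]
    refine ⟨by rw [hT]; positivity, fun t => t⁻¹, fun t ht => ⟨?_, ?_⟩⟩
    · rw [hT, one_div] at ht
      exact (le_inv_comm₀ ht.1 hΛ).1 ht.2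
    · refine (hasDerivAt_inv ht.1.ne').congr_deriv ?_
      beta_reduce
      ring
  · have hq : 0 < 1 - (γ / Λ) ^ 2 := by
      have h1 : γ / Λ < 1 := (div_lt_one hΛ).2 h
      have h2 : 0 < γ / Λ := by positivity
      nlinarith
    set r := rConst γ Λ with hr
    have hr0 : 0 < r := by
      rw [hr, rConst]; exact Real.sqrt_pos.2 (abs_pos.2 (by linarith))
    have hr2 : r ^ 2 = 1 - (γ / Λ) ^ 2 := by
      rw [hr, rConst, Real.sq_sqrt (abs_nonneg _), abs_of_neg (by linarith)]; ring
    have hr1 : r < 1 := by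
      have : 0 < (γ / Λ) ^ 2 := by positivity
      nlinarith
    set ω := Λ * r with hω
    have hω0 : 0 < ω := mul_pos hΛ hr0
    have hω2 : ω ^ 2 = Λ ^ 2 - γ ^ 2 := by
      rw [hω, mul_pow, hr2]; field_simp
    have hT : Tmax γ Λ = 1 / ω * Real.artanh r := by
      rw [Tmax, if_neg h.le.not_gt, if_neg h.ne]
    have ha : 0 < Real.artanh r := Real.artanh_pos ⟨hr0, hr1⟩
    refine ⟨by rw [hT]; positivity, fun t => ω * (Real.cosh (ω * t) / Real.sinh (ω * t)), ?_⟩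
    intro t ht
    have h1 : 0 < ω * t := mul_pos hω0 ht.1
    have h2 : ω * t ≤ Real.artanh r := by
      have := ht.2
      rw [hT, one_div, ← div_eq_inv_mul, le_div_iff₀ hω0] at this
      linarith
    have hs : 0 < Real.sinh (ω * t) := Real.sinh_pos_iff.2 h1
    have hc : 0 < Real.cosh (ω * t) := Real.cosh_pos _
    have htan : Real.sinh (ω * t) ≤ r * Real.cosh (ω * t) := by
      rw [← div_le_iff₀ hc, ← Real.tanh_eq_sinh_div_cosh]
      have h4 : Real.tanh (ω * t) ∈ Ioo (-1 : ℝ) 1 :=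
        ⟨Real.neg_one_lt_tanh _, Real.tanh_lt_one _⟩
      rw [← Real.artanh_le_artanh_iff h4 ⟨by linarith, hr1⟩, Real.artanh_tanh]
      exact h2
    constructor
    · beta_reduce
      rw [mul_div_assoc', le_div_iff₀ hs]
      refine (mul_le_mul_of_nonneg_left htan hΛ.le).trans_eq ?_
      linear_combination (-Real.cosh (ω * t)) * hω
    · have hd := (((hlin ω t).cosh.fun_div (hlin ω t).sinh hs.ne').const_mul ω)
      refine hd.congr_deriv ?_
      beta_reduce
      field_simp
      linear_combination Real.sinh (ω * t) ^ 2 * hω2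

theorem Tmax_pos {γ Λ : ℝ} (hγ : 0 < γ) (hΛ : 0 < Λ) : 0 < Tmax γ Λ := (exists_riccati hγ hΛ).1

/-- The weight of `W²` in the Lyapunov function for the flow between two sampling instants. -/
theorem exists_weight {γ Λ δ : ℝ} (hγ : 0 < γ) (hΛ : 0 < Λ) (hδ : δ ∈ Ioo (0 : ℝ) 1) :
    ∃ φ : ℝ → ℝ, ∀ t ∈ Icc 0 (δ * Tmax γ Λ),
      0 ≤ φ t ∧ HasDerivAt φ (-2 * Λ * φ t - γ * (1 + φ t ^ 2)) t := by
  obtain ⟨hT, ψ, hψ⟩ := exists_riccati hγ hΛ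
  -- The substitution `ψ = γφ + Λ` turns one Riccati equation into the other. The shift by `(1 - δ)
  -- T_max`, positive as `δ < 1`, keeps away from the pole of `ψ` at `0`.
  refine ⟨fun t => (ψ (t + (1 - δ) * Tmax γ Λ) - Λ) / γ, fun t ht => ?_⟩
  obtain ⟨h1, h2⟩ := hψ (t + (1 - δ) * Tmax γ Λ)
    ⟨by nlinarith [ht.1, hδ.2, mul_pos (sub_pos.2 hδ.2) hT], by linarith [ht.2]⟩
  refine ⟨div_nonneg (sub_nonneg.2 h1) hγ.le, ?_⟩
  have h3 := ((h2.comp_add_const t _).sub_const Λ).div_const γ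
  refine h3.congr_deriv ?_
  beta_reduce
  field_simp
  ring

theorem absolutelyContinuousOnInterval_of_hasDerivAt {φ φ' : ℝ → ℝ} {a b : ℝ}
    (h : ∀ t ∈ uIcc a b, HasDerivAt φ (φ' t) t) (hc : ContinuousOn φ' (uIcc a b)) :
    AbsolutelyContinuousOnInterval φ a b := by
  obtain ⟨C, hC⟩ := isCompact_Icc.exists_bound_of_continuousOn (s := uIcc a b) hc
  exact ((convex_uIcc a b).lipschitzOnWith_of_nnnorm_hasDerivWithin_le (C := C.toNNReal)
    (fun t ht => (h t ht).hasDerivWithinAt) fun t ht => by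
      rw [← NNReal.coe_le_coe, coe_nnnorm]
      exact (hC t ht).trans (Real.le_coe_toNNReal C)).absolutelyContinuousOnInterval

variable {np nc nu nw : ℕ} {P : Loop np nc nu nw} {V : Stacked np nc → ℝ} {αw : ℝ≥0 → ℝ≥0}
  {ε γ L : ℝ}

/-- The growth of `V` along the flow during at most `δ T_max(γ, Λ)` after a sampling instant. -/
theorem HybridLyapunov.le_of_flow (h : HybridLyapunov P V αw ε γ L)
    (hf : Continuous fun z : Stacked np nc × Stacked np nc × Vec nw => P.f z.1 z.2.1 z.2.2)
    {Λ δ : ℝ} (hΛ : 0 < Λ) (hLΛ : L + ε / 2 ≤ Λ) (hδ : δ ∈ Ioo (0 : ℝ) 1)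
    {x e : ℝ → Stacked np nc} {w : ℝ → Vec nw} {a b : ℝ} {μ : ℝ≥0} (hab : a ≤ b)
    (hb : b - a ≤ δ * Tmax γ Λ) (hx : AbsolutelyContinuousOnInterval x a b)
    (he : AbsolutelyContinuousOnInterval e a b)
    (hode : ∀ᵐ t, t ∈ Ioo a b → HasDerivAt x (P.f (x t) (e t) (w t)) t ∧
      HasDerivAt e (P.g (x t) (e t) (w t)) t ∧ ‖w t‖₊ ≤ μ) (hea : e a = 0) :
    V (x b) ≤ Real.exp (-ε * (b - a)) *
      (V (x a) + αw μ * Real.exp (|ε| * (b - a)) * (b - a)) := by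
  obtain ⟨hγ, hL, hV, hV0, hαw, W, H, αWlo, αWhi, αVlo, αVhi, hW, hW0, hH, hH0, hWlo, hWhi, hVlo,
    hVhi, hWb, hVb, hWg, hVg⟩ := h
  obtain ⟨φ, hφ⟩ := exists_weight (δ := δ) hγ hΛ hδ
  have hmem : ∀ t ∈ Icc a b, t - a ∈ Icc 0 (δ * Tmax γ Λ) := fun t ht =>
    ⟨sub_nonneg.2 ht.1, by linarith [ht.2]⟩
  have hφd : ∀ t ∈ Icc a b, HasDerivAt (fun s => φ (s - a))
      (-2 * Λ * φ (t - a) - γ * (1 + φ (t - a) ^ 2)) t := fun t ht =>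
    (hφ _ (hmem t ht)).2.comp_sub_const t a
  have hφc : ContinuousOn (fun s => φ (s - a)) (Icc a b) := fun t ht =>
    (hφd t ht).continuousAt.continuousWithinAt
  have hφac : AbsolutelyContinuousOnInterval (fun s => φ (s - a)) a b := by
    rw [← uIcc_of_le hab] at hφd hφc
    exact absolutelyContinuousOnInterval_of_hasDerivAt hφd
      ((continuousOn_const.mul hφc).sub
        (continuousOn_const.mul (continuousOn_const.add (hφc.pow 2))))
  have hexpd : ∀ t, HasDerivAt (fun s => Real.exp (ε * (s - a))) (Real.exp (ε * (t - a)) * ε) t :=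
    fun t => by
      have : HasDerivAt (fun s => ε * (s - a)) ε t := by
        simpa using ((hasDerivAt_id t).sub_const a).const_mul ε
      exact this.exp
  have hexpac : AbsolutelyContinuousOnInterval (fun s => Real.exp (ε * (s - a))) a b :=
    absolutelyContinuousOnInterval_of_hasDerivAt (fun t _ => hexpd t) (by fun_prop)
  have hVac := hx.locallyLipschitz_comp hV
  have hWac := he.locallyLipschitz_comp hW
  -- `U = V + γ φ W²` times the integrating factor `exp(ε(s - a))`; the sign of `ε` is unknown,
  -- whence `|ε|` in the bound.
  have hGac := hexpac.fun_mul (hVac.fun_add ((hφac.fun_mul (hWac.fun_mul hWac)).const_mul γ))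
  have hG := hGac.sub_le_of_hasDerivAt_le (M := αw μ * Real.exp (|ε| * (b - a))) hab (by
    filter_upwards [hode, hVac.ae_differentiableAt, hWac.ae_differentiableAt]
      with t hode hdV hdW ht d hd
    have htI := Ioo_subset_Icc_self ht
    obtain ⟨hxt, het, hwt⟩ := hode ht
    have hdV := (hdV (by rwa [uIcc_of_le hab])).hasDerivAt
    have hdW := (hdW (by rwa [uIcc_of_le hab])).hasDerivAt
    -- Here `e t` and `w t` are frozen, so no continuity of `w` in time is needed.
    have hVle := hV.hasDerivAt_comp_le (hVg (e t) (w t))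
      (Continuous.continuousAt (by fun_prop))
      (Continuous.continuousAt (by have := hV.continuous; fun_prop)) hxt hdV
    have hWle := hW.hasDerivAt_comp_le (hWg (x t) (w t))
      (Continuous.continuousAt (by unfold Loop.g; fun_prop))
      (Continuous.continuousAt (by have := hW.continuous; fun_prop)) het hdW
    have hdG := (hexpd t).mul (hdV.add (((hφd t htI).mul (hdW.mul hdW)).const_mul γ))
    rw [hd.unique hdG]
    set dV := deriv (fun s => V (x s)) t
    set dW := deriv (fun s => W (e s)) t
    have hφ0 := (hφ _ (hmem t htI)).1
    set p := φ (t - a)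
    have hW0 := hW0 (e t)
    have hA : (αw ‖w t‖₊ : ℝ) ≤ αw μ := by exact_mod_cast hαw.strictMono.monotone hwt
    -- `U' + ε U ≤ α_w`: the terms in `H` are absorbed by the square of `H - γ p W`, and the rest
    -- has the sign of `L + ε/2 - Λ ≤ 0`.
    have key : ε * (V (x t) + γ * (p * (W (e t) * W (e t)))) + (dV + γ * ((-2 * Λ * p -
        γ * (1 + p ^ 2)) * (W (e t) * W (e t)) + p * (dW * W (e t) + W (e t) * dW))) ≤ αw μ := by
      have h1 : γ * p * W (e t) * dW ≤ γ * p * W (e t) * (L * W (e t) + H (x t) (e t) (w t)) :=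
        mul_le_mul_of_nonneg_left hWle (by positivity)
      have h2 : 0 ≤ γ * p * W (e t) ^ 2 * (Λ - (L + ε / 2)) :=
        mul_nonneg (by positivity) (by linarith)
      nlinarith [sq_nonneg (H (x t) (e t) (w t) - γ * p * W (e t))]
    have hexp : Real.exp (ε * (t - a)) ≤ Real.exp (|ε| * (b - a)) := by
      apply Real.exp_le_exp.2
      have h1 : ε * (t - a) ≤ |ε| * (t - a) :=
        mul_le_mul_of_nonneg_right (le_abs_self ε) (by linarith [ht.1])
      have h2 : |ε| * (t - a) ≤ |ε| * (b - a) :=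
        mul_le_mul_of_nonneg_left (by linarith [ht.2]) (abs_nonneg ε)
      linarith
    have hmul := mul_le_mul_of_nonneg_left key (Real.exp_pos (ε * (t - a))).le
    have hmul' := mul_le_mul_of_nonneg_right hexp (αw μ).coe_nonneg
    simp only [Pi.add_apply, Pi.mul_apply]
    linarith)
  have hW00 : W (e a) = 0 := by
    have := (hWb (e a)).2
    rw [hea, nnnorm_zero, hWhi.zero] at this
    rw [hea]
    exact le_antisymm (by simpa using this) (hW0 0)
  have hφb := (hφ _ (hmem b ⟨hab, le_rfl⟩)).1
  have hexp1 : Real.exp (-ε * (b - a)) * Real.exp (ε * (b - a)) = 1 := by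
    rw [← Real.exp_add]; simp
  simp only [hW00, sub_self, mul_zero, add_zero, Real.exp_zero, one_mul] at hG
  have hfin := mul_le_mul_of_nonneg_left (sub_le_iff_le_add'.1 hG)
    (Real.exp_pos (-ε * (b - a))).le
  rw [← mul_assoc, hexp1, one_mul] at hfin
  have hpos : 0 ≤ γ * (φ (b - a) * (W (e b) * W (e b))) :=
    mul_nonneg hγ.le (mul_nonneg hφb (mul_self_nonneg _))
  linarith

/-! ### Hybrid time domains -/

section HybridTimeDomain

variable {dom : Set (ℝ × ℕ)}

theorem IsHybridTimeDomain.zero_mem (h : IsHybridTimeDomain dom) {t : ℝ} (ht : (t, 0) ∈ dom) :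
    ((0 : ℝ), 0) ∈ dom := by
  have h0 : 0 ≤ t := h.1 _ ht
  obtain ⟨J, s, hs0, hs, hD⟩ := h.2 t 0 ht
  have h1 : (t, 0) ∈ dom ∩ Icc 0 t ×ˢ Iic 0 := ⟨ht, ⟨h0, le_rfl⟩, mem_Iic.2 le_rfl⟩
  rw [hD] at h1
  have h2 : ((0 : ℝ), 0) ∈ dom ∩ Icc 0 t ×ˢ Iic 0 := by
    rw [hD]
    exact ⟨h1.1, hs0.le, by simpa [hs0] using hs 0 h1.1⟩
  exact h2.1

theorem IsHybridTimeDomain.exists_jump (h : IsHybridTimeDomain dom) {t : ℝ} {k : ℕ}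
    (ht : (t, k + 1) ∈ dom) : ∃ s ≤ t, (s, k) ∈ dom ∧ (s, k + 1) ∈ dom := by
  have h0 : 0 ≤ t := h.1 _ ht
  obtain ⟨J, s, hs0, hs, hD⟩ := h.2 t (k + 1) ht
  have h1 : (t, k + 1) ∈ dom ∩ Icc 0 t ×ˢ Iic (k + 1) := ⟨ht, ⟨h0, le_rfl⟩, mem_Iic.2 le_rfl⟩
  rw [hD] at h1
  obtain ⟨hJ, h2, h3⟩ := h1
  dsimp only at hJ h2 h3
  refine ⟨s (k + 1), h2, ?_, ?_⟩
  · have h4 : (s (k + 1), k) ∈ dom ∩ Icc 0 t ×ˢ Iic (k + 1) := by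
      rw [hD]
      exact ⟨(Nat.lt_succ_self k).trans hJ, hs k ((Nat.lt_succ_self k).trans hJ), le_rfl⟩
    exact h4.1
  · have h4 : (s (k + 1), k + 1) ∈ dom ∩ Icc 0 t ×ˢ Iic (k + 1) := by
      rw [hD]
      exact ⟨hJ, le_rfl, hs (k + 1) hJ⟩
    exact h4.1

theorem IsHybridTimeDomain.Icc_subset_section (h : IsHybridTimeDomain dom) {a b : ℝ} {j : ℕ}
    (ha : (a, j) ∈ dom) (hb : (b, j) ∈ dom) : Icc a b ⊆ section_ dom j := by
  intro u hu
  have ha0 : 0 ≤ a := h.1 _ ha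
  obtain ⟨J, s, hs0, hs, hD⟩ := h.2 b j hb
  have h1 : (a, j) ∈ dom ∩ Icc 0 b ×ˢ Iic j := ⟨ha, ⟨ha0, hu.1.trans hu.2⟩, mem_Iic.2 le_rfl⟩
  have h2 : (b, j) ∈ dom ∩ Icc 0 b ×ˢ Iic j :=
    ⟨hb, ⟨ha0.trans (hu.1.trans hu.2), le_rfl⟩, mem_Iic.2 le_rfl⟩
  rw [hD] at h1 h2
  have h3 : (u, j) ∈ dom ∩ Icc 0 b ×ˢ Iic j := by
    rw [hD]
    exact ⟨h1.1, h1.2.1.trans hu.1, hu.2.trans h2.2.2⟩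
  exact h3.1

theorem HybridSystem.IsSolution.ae_hasDerivAt {Ξ W : Type*} [NormedAddCommGroup Ξ]
    [NormedSpace ℝ Ξ] [NormedAddCommGroup W] {S : HybridSystem Ξ W} {w : ℝ → W} {ξ : ℝ → ℕ → Ξ}
    (hξ : S.IsSolution w dom ξ) {a b : ℝ} {j : ℕ} (ha : (a, j) ∈ dom) (hb : (b, j) ∈ dom) :
    ∀ᵐ t : ℝ, t ∈ Ioo a b →
      ξ t j ∈ S.C ∧ HasDerivAt (fun s => ξ s j) (S.F (ξ t j) (w t)) t := by
  have hsub := hξ.domain.Icc_subset_section ha hb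
  filter_upwards [hξ.flow j] with t ht hm
  obtain ⟨h1, h2⟩ := ht (hsub (Ioo_subset_Icc_self hm))
  exact ⟨h1, h2.hasDerivAt (mem_of_superset (Icc_mem_nhds hm.1 hm.2) hsub)⟩

end HybridTimeDomain

/-! ### Flow and jumps of the closed loop -/

section ClosedLoop

variable {np nc nu nw : ℕ} {P : Loop np nc nu nw} {Γ : Stacked np nc → ℝ → ℝ}
  {S : ℝ → Stacked np nc → ℝ} {dom : Set (ℝ × ℕ)} {w : ℝ → Vec nw} {ξ : ℝ → ℕ → State np nc ℝ}

theorem absolutelyContinuous_components {a b : ℝ} {j : ℕ}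
    (h : AbsolutelyContinuousOnInterval (fun t => ξ t j) a b) :
    AbsolutelyContinuousOnInterval (fun t => (ξ t j).x) a b ∧
    AbsolutelyContinuousOnInterval (fun t => (ξ t j).e) a b ∧
    AbsolutelyContinuousOnInterval (fun t => (ξ t j).η) a b ∧
    AbsolutelyContinuousOnInterval (fun t => (ξ t j).τ) a b ∧
    AbsolutelyContinuousOnInterval (fun t => (ξ t j).τmax) a b := by
  have h1 := h.lipschitzWith_comp LipschitzWith.prod_snd
  have h2 := h1.lipschitzWith_comp LipschitzWith.prod_snd
  have h3 := h2.lipschitzWith_comp LipschitzWith.prod_snd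
  exact ⟨h.lipschitzWith_comp LipschitzWith.prod_fst, h1.lipschitzWith_comp LipschitzWith.prod_fst,
    h2.lipschitzWith_comp LipschitzWith.prod_fst, h3.lipschitzWith_comp LipschitzWith.prod_fst,
    h3.lipschitzWith_comp LipschitzWith.prod_snd⟩

theorem hasDerivAt_components {t : ℝ} {j : ℕ}
    (h : HasDerivAt (fun s => ξ s j) ((closedLoop P Γ S).F (ξ t j) (w t)) t) :
    HasDerivAt (fun s => (ξ s j).x) (P.f (ξ t j).x (ξ t j).e (w t)) t ∧
    HasDerivAt (fun s => (ξ s j).e) (P.g (ξ t j).x (ξ t j).e (w t)) t ∧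
    HasDerivAt (fun s => (ξ s j).η) 0 t ∧
    HasDerivAt (fun s => (ξ s j).τ) 1 t ∧
    HasDerivAt (fun s => (ξ s j).τmax) 0 t := by
  have h1 := hasFDerivAt_snd.comp_hasDerivAt t h
  have h2 := hasFDerivAt_snd.comp_hasDerivAt t h1
  have h3 := hasFDerivAt_snd.comp_hasDerivAt t h2
  have g1 := hasFDerivAt_fst.comp_hasDerivAt t h
  have g2 := hasFDerivAt_fst.comp_hasDerivAt t h1
  have g3 := hasFDerivAt_fst.comp_hasDerivAt t h2
  have g4 := hasFDerivAt_fst.comp_hasDerivAt t h3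
  have g5 := hasFDerivAt_snd.comp_hasDerivAt t h3
  exact ⟨g1, g2, g3, g4, g5⟩

/-- The evolution of the components of a solution of the closed loop between two jumps. -/
theorem flow_components (hξ : (closedLoop P Γ S).IsSolution w dom ξ) {a b : ℝ} {j : ℕ}
    (hab : a ≤ b) (ha : (a, j) ∈ dom) (hb : (b, j) ∈ dom) :
    (ξ b j).e = (ξ a j).e + (ξ a j).x - (ξ b j).x ∧ (ξ b j).η = (ξ a j).η ∧
    (ξ b j).τ = (ξ a j).τ + (b - a) ∧ (ξ b j).τmax = (ξ a j).τmax := by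
  obtain ⟨hx, he, hη, hτ, hm⟩ := absolutelyContinuous_components (hξ.absCont j a ha b hb)
  have hd : ∀ᵐ t : ℝ, t ∈ Ioo a b →
      HasDerivAt (fun s => ξ s j) ((closedLoop P Γ S).F (ξ t j) (w t)) t :=
    (hξ.ae_hasDerivAt ha hb).mono fun t ht h => (ht h).2
  have hη' := hη.eq_of_hasDerivAt_const hab (hd.mono fun t ht h =>
    (hasDerivAt_components (ht h)).2.2.1)
  have hτ' := hτ.eq_of_hasDerivAt_const hab (hd.mono fun t ht h =>
    (hasDerivAt_components (ht h)).2.2.2.1)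
  have hm' := hm.eq_of_hasDerivAt_const hab (hd.mono fun t ht h =>
    (hasDerivAt_components (ht h)).2.2.2.2)
  -- As `g = -f`, the held value `x + e` is constant along the flow.
  obtain ⟨c, hc⟩ := (hx.fun_add he).const_of_ae_hasDerivAt_zero (by
    filter_upwards [hd, compl_mem_ae_iff.2 (measure_singleton (μ := volume) a),
      compl_mem_ae_iff.2 (measure_singleton (μ := volume) b)] with t ht hta htb hmem
    rw [uIcc_of_le hab] at hmem
    have h := hasDerivAt_components (ht ⟨lt_of_le_of_ne hmem.1 (Ne.symm hta),
      lt_of_le_of_ne hmem.2 htb⟩)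
    simpa [Loop.g] using h.1.fun_add h.2.1)
  have hxe := (hc b right_mem_uIcc).trans (hc a left_mem_uIcc).symm
  refine ⟨?_, by linarith, by linarith, by linarith⟩
  rw [add_comm (ξ a j).e, ← hxe, add_sub_cancel_left]

/-- The flow condition holds only for almost all times. But `τ - τ_max` grows with slope one, so a
violation at `b` would already hold on an interval of positive length before `b`. -/
theorem τ_le_τmax (hξ : (closedLoop P Γ S).IsSolution w dom ξ) {a b : ℝ} {j : ℕ}
    (hab : a < b) (ha : (a, j) ∈ dom) (hb : (b, j) ∈ dom) : (ξ b j).τ ≤ (ξ b j).τmax := by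
  by_contra! hlt
  obtain ⟨-, -, hτ, hm⟩ := flow_components hξ hab.le ha hb
  have hsub := hξ.domain.Icc_subset_section ha hb
  set c := max a (b - ((ξ b j).τ - (ξ b j).τmax)) with hc
  have hcb : c < b := max_lt hab (by linarith)
  have hnull : (volume (Ioo c b)) ≠ 0 := by simp [hcb]
  refine hnull (measure_mono_null (fun t ht => ?_) (hξ.ae_hasDerivAt ha hb))
  have hta : a < t := (le_max_left _ _).trans_lt ht.1
  have htc : b - ((ξ b j).τ - (ξ b j).τmax) < t := (le_max_right _ _).trans_lt ht.1
  obtain ⟨-, -, hτ', hm'⟩ := flow_components hξ hta.le ha (hsub ⟨hta.le, ht.2.le⟩)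
  intro h
  have h1 : (ξ t j).τ ≤ (ξ t j).τmax := (h ⟨hta, ht.2⟩).1
  linarith

/-- The state after a flow of duration `t - t₀` following the jump at `(t₀, j)`. -/
theorem components_after_jump (hξ : (closedLoop P Γ S).IsSolution w dom ξ) {t₀ t : ℝ} {j : ℕ}
    (htt : t₀ ≤ t) (h0 : (t₀, j) ∈ dom) (h1 : (t₀, j + 1) ∈ dom) (ht : (t, j + 1) ∈ dom) :
    (ξ t₀ (j + 1)).x = (ξ t₀ j).x ∧ (ξ t₀ (j + 1)).e = 0 ∧
    (ξ t (j + 1)).e = (ξ t₀ j).x - (ξ t (j + 1)).x ∧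
    (ξ t (j + 1)).η = S (ξ t₀ j).η (ξ t₀ j).x ∧ (ξ t (j + 1)).τ = t - t₀ ∧
    (ξ t (j + 1)).τmax = Γ (ξ t₀ j).x (ξ t₀ j).η := by
  have hj := (hξ.jump t₀ j h0 h1).2
  obtain ⟨h2, h3, h4, h5⟩ := flow_components hξ htt h1 ht
  rw [h2, h3, h4, h5, hj]
  refine ⟨rfl, rfl, ?_, rfl, zero_add _, rfl⟩
  exact congrArg (· - _) (zero_add _)

/-- The time between two consecutive jumps, in whichever order they occur. -/
theorem sub_eq_of_jumps (hξ : (closedLoop P Γ S).IsSolution w dom ξ)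
    {t₀ t : ℝ} {j : ℕ}
    (h0 : (t₀, j) ∈ dom) (h1 : (t₀, j + 1) ∈ dom) (h2 : (t, j + 1) ∈ dom)
    (h3 : (t, j + 2) ∈ dom) : t - t₀ = Γ (ξ t₀ j).x (ξ t₀ j).η := by
  have hD : (ξ t (j + 1)).τ = (ξ t (j + 1)).τmax := (hξ.jump t (j + 1) h2 h3).1
  rcases le_total t₀ t with h | h
  · obtain ⟨-, -, -, -, h4, h5⟩ := components_after_jump hξ h h0 h1 h2
    rw [← h4, ← h5, hD]
  -- Flowing from `t` to `t₀` gives the same identity, so this order need not be excluded.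
  · obtain ⟨-, -, h4, h5⟩ := flow_components hξ h h2 h1
    obtain ⟨-, -, -, -, h6, h7⟩ := components_after_jump hξ le_rfl h0 h1 h1
    linarith

/-- With an admissible initial condition there is no flow before the first jump. -/
theorem eq_zero_of_mem_section_zero (hξ : (closedLoop P Γ S).IsSolution w dom ξ)
    (h0 : (ξ 0 0).IsInitial) {t : ℝ} (ht : (t, 0) ∈ dom) : t = 0 := by
  have hz := hξ.domain.zero_mem ht
  by_contra hne
  have hpos : 0 < t := lt_of_le_of_ne (hξ.domain.1 _ ht) (Ne.symm hne)
  obtain ⟨-, -, h1, h2⟩ := flow_components hξ hpos.le hz ht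
  have h3 := τ_le_τmax hξ hpos hz ht
  have h4 := h0.2
  linarith

end ClosedLoop

/-! ### The sampling interval -/

section Sampling

theorem foldl_max_cases {ι : Type*} (f : ι → ℝ) (l : List ι) (a : ℝ) :
    a ≤ l.foldl (fun h i => if h < f i then f i else h) a ∧
    (l.foldl (fun h i => if h < f i then f i else h) a = a ∨
      ∃ i, l.foldl (fun h i => if h < f i then f i else h) a = f i ∧ a < f i) := by
  induction l generalizing a with
  | nil => exact ⟨le_rfl, Or.inl rfl⟩
  | cons k l ih =>
    rw [List.foldl_cons]
    split_ifs with h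
    · obtain ⟨h1, h2⟩ := ih (f k)
      refine ⟨h.le.trans h1, Or.inr ?_⟩
      rcases h2 with h2 | ⟨i, h2, h3⟩
      · exact ⟨k, h2, h⟩
      · exact ⟨i, h2, h.trans h3⟩
    · exact ih a

/-- The strict inequality in the last alternative makes the candidate positive once `t_min > 0`,
which rules out the default `0` used when `C < V`. -/
theorem sampling_cases {n : ℕ} (δ εref : ℝ) (ε γ L : Fin (n + 1) → ℝ) (v c : ℝ) :
    tmin δ (ε 0) (γ 0) (L 0) ≤ sampling δ εref ε γ L v c ∧
    (sampling δ εref ε γ L v c = tmin δ (ε 0) (γ 0) (L 0) ∨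
      ∃ i : Fin n, sampling δ εref ε γ L v c =
          candidate δ εref (ε i.succ) (γ i.succ) (L i.succ) v c ∧
        tmin δ (ε 0) (γ 0) (L 0) < candidate δ εref (ε i.succ) (γ i.succ) (L i.succ) v c) :=
  foldl_max_cases (fun i : Fin n => candidate δ εref (ε i.succ) (γ i.succ) (L i.succ) v c) _ _

theorem candidate_le {δ εref ε γ L : ℝ} (hγ : 0 < γ) (hδ : δ ∈ Ioo (0 : ℝ) 1) (v c : ℝ) :
    candidate δ εref ε γ L v c ≤ δ * Tmax γ (max (L + ε / 2) (1 - δ)) := by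
  have hT : 0 < Tmax γ (max (L + ε / 2) (1 - δ)) :=
    Tmax_pos hγ (lt_max_of_lt_right (sub_pos.2 hδ.2))
  unfold candidate
  split_ifs
  · exact min_le_left _ _
  · exact le_rfl
  · exact mul_nonneg hδ.1.le hT.le

/-- The quotient of logarithms is the time at which `exp(-ε t) v` catches up with `exp(-ε_ref t) c`.
There is no such time if `ε ≥ ε_ref` or `v = 0`. -/
theorem exp_mul_le_of_le_candidate {δ εref ε γ L v c t : ℝ} (hv : 0 ≤ v)
    (hpos : 0 < candidate δ εref ε γ L v c) (ht0 : 0 ≤ t)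
    (ht : t ≤ candidate δ εref ε γ L v c) :
    Real.exp (-ε * t) * v ≤ Real.exp (-εref * t) * c := by
  unfold candidate at hpos ht
  split_ifs at hpos ht with h1 h2
  · have hv0 : 0 < v := lt_of_le_of_ne hv (Ne.symm h2.2)
    have h3 := ht.trans (min_le_right _ _)
    rw [le_div_iff₀ h2.1] at h3
    rw [← Real.exp_log hv0, ← Real.exp_log (hv0.trans_le h1), ← Real.exp_add, ← Real.exp_add]
    exact Real.exp_le_exp.2 (by linarith)
  · rcases hv.eq_or_lt with rfl | hv0
    · rw [mul_zero]; positivity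
    · have h3 : -ε ≤ -εref := by
        by_contra! h
        exact h2 ⟨by linarith, hv0.ne'⟩
      gcongr
  · exact absurd hpos (lt_irrefl _)

end Sampling

/-! ### Comparison functions -/

section Comparison

theorem IsClassK.comp {ρ σ : ℝ≥0 → ℝ≥0} (hρ : IsClassK ρ) (hσ : IsClassK σ) :
    IsClassK fun s => ρ (σ s) :=
  ⟨hρ.continuous.comp hσ.continuous, hρ.strictMono.comp hσ.strictMono, by
    rw [hσ.zero, hρ.zero]⟩

theorem IsClassK.const_mul {ρ : ℝ≥0 → ℝ≥0} (hρ : IsClassK ρ) {k : ℝ≥0} (hk : 0 < k) :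
    IsClassK fun s => k * ρ s :=
  ⟨continuous_const.mul hρ.continuous, fun _ _ h => mul_lt_mul_of_pos_left (hρ.strictMono h) hk,
    by rw [hρ.zero, mul_zero]⟩

theorem IsClassK.add_id {ρ : ℝ≥0 → ℝ≥0} (hρ : IsClassK ρ) : IsClassK fun s => ρ s + s :=
  ⟨hρ.continuous.add continuous_id, fun _ _ h => add_lt_add (hρ.strictMono h) h,
    by rw [hρ.zero, add_zero]⟩

theorem isClassK_const_mul_id {k : ℝ≥0} (hk : 0 < k) : IsClassK fun s => k * s :=
  ⟨by fun_prop, fun _ _ h => mul_lt_mul_of_pos_left h hk, mul_zero k⟩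

theorem IsClassKInf.surjective {α : ℝ≥0 → ℝ≥0} (hα : IsClassKInf α) :
    Function.Surjective α := by
  intro y
  obtain ⟨z, ⟨x, rfl⟩, hx⟩ := not_bddAbove_iff.1 hα.unbounded y
  obtain ⟨u, -, hu⟩ := intermediate_value_Icc (zero_le (a := x)) hα.continuous.continuousOn
    (show y ∈ Icc (α 0) (α x) from ⟨by simp [hα.zero], hx.le⟩)
  exact ⟨u, hu⟩

theorem IsClassKInf.exists_inverse {α : ℝ≥0 → ℝ≥0} (hα : IsClassKInf α) :
    ∃ κ : ℝ≥0 → ℝ≥0, IsClassK κ ∧ ∀ a b, α a ≤ b → a ≤ κ b := by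
  let f := hα.strictMono.orderIsoOfSurjective α hα.surjective
  have hf : ∀ a, f a = α a := fun a => rfl
  refine ⟨f.symm, ⟨f.symm.continuous, f.symm.strictMono, ?_⟩, fun a b h => ?_⟩
  · rw [OrderIso.symm_apply_eq, hf, hα.zero]
  · rw [OrderIso.le_symm_apply, hf]; exact h

/-- The exponential decay `e^{-lt}` as a nonnegative number. -/
noncomputable def decay (l : ℝ) (t : ℝ≥0) : ℝ≥0 := (Real.exp (-(l * t))).toNNReal

theorem coe_decay (l : ℝ) (t : ℝ≥0) : (decay l t : ℝ) = Real.exp (-(l * t)) :=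
  Real.coe_toNNReal _ (Real.exp_pos _).le

theorem decay_pos (l : ℝ) (t : ℝ≥0) : 0 < decay l t := Real.toNNReal_pos.2 (Real.exp_pos _)

theorem isClassKL_decay {ρ σ : ℝ≥0 → ℝ≥0} (hρ : IsClassK ρ) (hσ : IsClassK σ) {k : ℝ≥0}
    (hk : 0 < k) {l : ℝ} (hl : 0 < l) : IsClassKL fun q t => ρ (k * decay l t * σ q) := by
  have hc : Continuous (decay l) := by unfold decay; fun_prop
  refine ⟨?_, fun t => hρ.comp (hσ.const_mul (mul_pos hk (decay_pos l t))), fun q s t hst => ?_,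
    fun q => ?_⟩
  · have h1 := hρ.continuous
    have h2 := hσ.continuous
    fun_prop
  · apply hρ.strictMono.monotone
    gcongr
    apply Real.toNNReal_le_toNNReal
    have : (s : ℝ) ≤ t := by exact_mod_cast hst
    gcongr
  · have h1 : Tendsto (decay l) atTop (𝓝 0) := by
      rw [← NNReal.tendsto_coe]
      simp only [coe_decay, NNReal.coe_zero]
      refine Real.tendsto_exp_neg_atTop_nhds_zero.comp ?_
      exact (NNReal.tendsto_coe_atTop.2 tendsto_id).const_mul_atTop hl
    have h2 : Tendsto (fun t => k * decay l t * σ q) atTop (𝓝 0) := by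
      simpa using (h1.const_mul k).mul_const (σ q)
    have h3 := (hρ.continuous.tendsto 0).comp h2
    rw [hρ.zero] at h3
    exact h3

theorem isClassKLL_decay {ρ σ : ℝ≥0 → ℝ≥0} (hρ : IsClassK ρ) (hσ : IsClassK σ) {k : ℝ≥0}
    (hk : 0 < k) {l m : ℝ} (hl : 0 < l) (hm : 0 < m) :
    IsClassKLL fun q t j => ρ (k * decay l t * decay m j * σ q) := by
  refine ⟨fun r => ?_, fun r => ?_⟩
  · exact isClassKL_decay hρ hσ (mul_pos hk (decay_pos l r)) hm
  · have := isClassKL_decay hρ hσ (mul_pos hk (decay_pos m r)) hl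
    simpa only [mul_right_comm k] using this

theorem IsClassK.apply_add_le {κ : ℝ≥0 → ℝ≥0} (hκ : IsClassK κ) (a b : ℝ≥0) :
    κ (a + b) ≤ κ (2 * a) + κ (2 * b) := by
  rcases le_total a b with h | h
  · exact (hκ.strictMono.monotone (by rw [two_mul]; gcongr)).trans le_add_self
  · exact (hκ.strictMono.monotone (by rw [two_mul]; gcongr)).trans le_self_add

end Comparison

/-! ### From decay between samplings to input-to-state stability -/

section Stability

variable {np nc nu nw : ℕ}

theorem State.size_le (ξ : State np nc ℝ) : ξ.size ≤ ‖ξ.x‖₊ + ‖ξ.e‖₊ + ‖ξ.η‖₊ := by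
  unfold State.size
  rw [NNReal.sqrt_le_iff_le_sq, ← NNReal.coe_le_coe]
  push_cast
  nlinarith [norm_nonneg ξ.x, norm_nonneg ξ.e, norm_nonneg ξ.η,
    mul_nonneg (norm_nonneg ξ.x) (norm_nonneg ξ.e), mul_nonneg (norm_nonneg ξ.x) (norm_nonneg ξ.η),
    mul_nonneg (norm_nonneg ξ.e) (norm_nonneg ξ.η)]

theorem State.nnnorm_x_le_size (ξ : State np nc ℝ) : ‖ξ.x‖₊ ≤ ξ.size := by
  unfold State.size
  rw [NNReal.le_sqrt_iff_sq_le, add_assoc]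
  exact le_self_add

theorem State.nnnorm_η_le_size (ξ : State np nc ℝ) : ‖ξ.η‖₊ ≤ ξ.size := by
  unfold State.size
  rw [NNReal.le_sqrt_iff_sq_le]
  exact le_add_self

theorem ae_nnnorm_le_supNorm {w : ℝ → Vec nw} (hw : supNorm w ≠ ⊤) :
    ∀ᵐ t : ℝ, 0 ≤ t → ‖w t‖₊ ≤ (supNorm w).toNNReal := by
  have h := ae_le_eLpNormEssSup (f := w) (μ := volume.restrict (Ici (0 : ℝ)))
  rw [ae_restrict_iff' measurableSet_Ici] at h
  filter_upwards [h] with t ht h0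
  rw [← ENNReal.coe_le_coe, ENNReal.coe_toNNReal hw]
  exact ht h0

/-- `V` and the dynamic variable decay from one jump to the next at rate `l`, up to the gain
`M` of the input. -/
def StepDecay (P : Loop np nc nu nw) (Γ : Stacked np nc → ℝ → ℝ) (S : ℝ → Stacked np nc → ℝ)
    (V : Stacked np nc → ℝ) (αw : ℝ≥0 → ℝ≥0) (l M : ℝ) : Prop :=
  ∀ (w : ℝ → Vec nw) (dom : Set (ℝ × ℕ)) (ξ : ℝ → ℕ → State np nc ℝ) (μ : ℝ≥0),
    (closedLoop P Γ S).IsSolution w dom ξ → (∀ᵐ t : ℝ, 0 ≤ t → ‖w t‖₊ ≤ μ) →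
    ∀ t₀ t j, t₀ ≤ t → (t₀, j) ∈ dom → (t₀, j + 1) ∈ dom → (t, j + 1) ∈ dom →
      t - t₀ ≤ Γ (ξ t₀ j).x (ξ t₀ j).η ∧
      max (V (ξ t (j + 1)).x) |(ξ t (j + 1)).η| ≤
        Real.exp (-l * (t - t₀)) * max (V (ξ t₀ j).x) |(ξ t₀ j).η| + αw μ * M

variable {P : Loop np nc nu nw} {Γ : Stacked np nc → ℝ → ℝ} {S : ℝ → Stacked np nc → ℝ}
  {V : Stacked np nc → ℝ} {αw : ℝ≥0 → ℝ≥0} {l M tm : ℝ}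

/-- The decay from jump to jump adds up to an exponential estimate at the jump times. -/
theorem StepDecay.le_at_jump (h : StepDecay P Γ S V αw l M) (hl : 0 < l) (hM : 0 < M)
    (htm : 0 < tm) (hΓ : ∀ x η, tm ≤ Γ x η) {w : ℝ → Vec nw} {dom : Set (ℝ × ℕ)}
    {ξ : ℝ → ℕ → State np nc ℝ} {μ : ℝ≥0} (hξ : (closedLoop P Γ S).IsSolution w dom ξ)
    (h0 : (ξ 0 0).IsInitial) (hw : ∀ᵐ t : ℝ, 0 ≤ t → ‖w t‖₊ ≤ μ) (j : ℕ) :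
    ∀ t, (t, j) ∈ dom → (t, j + 1) ∈ dom → j * tm ≤ t ∧
      max (V (ξ t j).x) |(ξ t j).η| ≤ Real.exp (-l * t) * max (V (ξ 0 0).x) |(ξ 0 0).η| +
        αw μ * (M / (1 - Real.exp (-l * tm))) := by
  have hq : 0 < 1 - Real.exp (-l * tm) := by
    have : Real.exp (-l * tm) < 1 := Real.exp_lt_one_iff.2 (by nlinarith)
    linarith
  induction j with
  | zero =>
    intro t ht _
    rw [eq_zero_of_mem_section_zero hξ h0 ht]
    refine ⟨by simp, ?_⟩
    simp only [mul_zero, Real.exp_zero, one_mul]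
    exact le_add_of_nonneg_right (by positivity)
  | succ j ih =>
    intro t ht ht'
    obtain ⟨s, hs, hsj, hsj'⟩ := hξ.domain.exists_jump ht
    obtain ⟨h1, h2⟩ := ih s hsj hsj'
    have h3 := sub_eq_of_jumps hξ hsj hsj' ht ht'
    have h4 : tm ≤ t - s := h3 ▸ hΓ _ _
    refine ⟨by push_cast; linarith, ?_⟩
    refine (h w dom ξ μ hξ hw s t j hs hsj hsj' ht).2.trans ?_
    have h5 : Real.exp (-l * (t - s)) ≤ Real.exp (-l * tm) :=
      Real.exp_le_exp.2 (by nlinarith)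
    have h6 : Real.exp (-l * (t - s)) * Real.exp (-l * s) = Real.exp (-l * t) := by
      rw [← Real.exp_add]; ring_nf
    set q := Real.exp (-l * tm)
    calc _ ≤ Real.exp (-l * (t - s)) * (Real.exp (-l * s) * max (V (ξ 0 0).x) |(ξ 0 0).η| +
          αw μ * (M / (1 - q))) + αw μ * M := by gcongr
      _ = Real.exp (-l * t) * max (V (ξ 0 0).x) |(ξ 0 0).η| +
          (Real.exp (-l * (t - s)) * (αw μ * (M / (1 - q))) + αw μ * M) := by
        rw [← h6]; ring
      _ ≤ Real.exp (-l * t) * max (V (ξ 0 0).x) |(ξ 0 0).η| +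
          (q * (αw μ * (M / (1 - q))) + αw μ * M) := by gcongr
      -- `M / (1 - q)` is the fixed point of `m ↦ q m + M`.
      _ = _ := by
        field_simp
        ring

/-- At any time after the first jump, the state is bounded through `N` at the last jump and at the
present time. Before it there is no flow, and the initial `e` is erased by the jump. -/
theorem StepDecay.isISS (h : StepDecay P Γ S V αw l M) (hl : 0 < l) (hM : 0 < M)
    (htm : 0 < tm) (hΓ : ∀ x η, tm ≤ Γ x η) {T : ℝ} (hT : ∀ x η, Γ x η ≤ T)
    (hαw : IsClassKInf αw) {αlo αhi : ℝ≥0 → ℝ≥0} (hlo : IsClassKInf αlo) (hhi : IsClassKInf αhi)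
    (hV : ∀ x, αlo ‖x‖₊ ≤ V x ∧ V x ≤ αhi ‖x‖₊) : IsISS (closedLoop P Γ S) := by
  obtain ⟨κ, hκ, hκle⟩ := hlo.exists_inverse
  have hq : 0 < 1 - Real.exp (-l * tm) := by
    have : Real.exp (-l * tm) < 1 := Real.exp_lt_one_iff.2 (by nlinarith)
    linarith
  have hT0 : 0 < T := htm.trans_le ((hΓ 0 0).trans (hT 0 0))
  obtain ⟨C, hC⟩ : ∃ C : ℝ≥0, (C : ℝ) = M / (1 - Real.exp (-l * tm)) + M :=
    ⟨⟨_, by positivity⟩, rfl⟩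
  have hC0 : 0 < C := by rw [← NNReal.coe_pos, hC]; positivity
  obtain ⟨K, hK⟩ : ∃ K : ℝ≥0, (K : ℝ) = Real.exp (l * T + l * tm / 2) :=
    ⟨⟨_, (Real.exp_pos _).le⟩, rfl⟩
  have hK1 : 1 ≤ K := by
    rw [← NNReal.coe_le_coe, hK]; exact Real.one_le_exp (by positivity)
  -- Three terms `κ`: one for `x` and two for `e`, a difference of two values of `x`. The doubled
  -- argument splits `κ (a + b)`; the summand `s` bounds `η` and, at time zero, the whole state.
  have hρ : IsClassK fun s => 3 * κ (2 * s) + s :=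
    ((hκ.comp (isClassK_const_mul_id two_pos)).const_mul three_pos).add_id
  have hσ : IsClassK fun s => αhi s + s := hhi.add_id
  set ρ : ℝ≥0 → ℝ≥0 := fun s => 3 * κ (2 * s) + s with hρdef
  set σ : ℝ≥0 → ℝ≥0 := fun s => αhi s + s with hσdef
  refine ⟨fun q t j => ρ (K * decay (l / 2) t * decay (l * tm / 2) j * σ q),
    fun s => ρ (C * αw s), isClassKLL_decay hρ hσ (one_pos.trans_le hK1) (by positivity)
      (by positivity), ⟨hρ.comp (hαw.const_mul hC0), ?_⟩, ?_⟩
  · rw [not_bddAbove_iff]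
    intro y
    obtain ⟨z, ⟨s, rfl⟩, hs⟩ := not_bddAbove_iff.1 hαw.unbounded (C⁻¹ * y)
    refine ⟨_, ⟨s, rfl⟩, lt_of_lt_of_le ?_ le_add_self⟩
    rwa [← inv_mul_lt_iff₀ hC0]
  · intro w dom ξ hξ h0 hw t j htj
    have hwae := ae_nnnorm_le_supNorm hw
    set μ := (supNorm w).toNNReal
    have ht0 : 0 ≤ t := hξ.domain.1 _ htj
    set N₀ := max (V (ξ 0 0).x) |(ξ 0 0).η| with hN₀
    have hN₀le : N₀ ≤ σ (ξ 0 0).size := by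
      rw [hσdef]
      push_cast
      have h1 : V (ξ 0 0).x ≤ αhi (ξ 0 0).size := (hV _).2.trans
        (by exact_mod_cast hhi.strictMono.monotone (State.nnnorm_x_le_size _))
      have h2 : |(ξ 0 0).η| ≤ (ξ 0 0).size := by
        rw [← Real.norm_eq_abs, ← coe_nnnorm]
        exact_mod_cast State.nnnorm_η_le_size _
      exact max_le (h1.trans (le_add_of_nonneg_right (NNReal.coe_nonneg _)))
        (h2.trans (le_add_of_nonneg_left (NNReal.coe_nonneg _)))
    rcases j with _ | k
    · rw [eq_zero_of_mem_section_zero hξ h0 htj]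
      refine le_trans ?_ le_self_add
      have hdec : ∀ c, decay c 0 = 1 := fun c => by simp [decay]
      simp only [Real.toNNReal_zero, Nat.cast_zero, hdec, mul_one]
      calc (ξ 0 0).size ≤ σ (ξ 0 0).size := le_add_self
        _ ≤ K * σ (ξ 0 0).size := le_mul_of_one_le_left zero_le hK1
        _ ≤ ρ (K * σ (ξ 0 0).size) := le_add_self
    · obtain ⟨s, hst, hsk, hsk'⟩ := hξ.domain.exists_jump htj
      obtain ⟨hks, hNs⟩ := h.le_at_jump hl hM htm hΓ hξ h0 hwae k s hsk hsk'
      obtain ⟨hts, hNt⟩ := h w dom ξ μ hξ hwae s t k hst hsk hsk' htj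
      have htsT := hts.trans (hT _ _)
      obtain ⟨-, -, he, -, -, -⟩ := components_after_jump hξ hst hsk hsk' htj
      set a := K * decay (l / 2) t.toNNReal * decay (l * tm / 2) (k + 1 : ℕ) * σ (ξ 0 0).size
        with ha
      set b := C * αw μ with hb
      -- Half of the exponent gives decay in `t` through `s ≥ t - T`, the other half decay in `j`
      -- through `s ≥ k t_min`; `K` absorbs the offsets, including that from `k` to `k + 1`.
      have hexp : Real.exp (-l * s) ≤
          K * decay (l / 2) t.toNNReal * decay (l * tm / 2) (k + 1 : ℕ) := by
        rw [hK, coe_decay, coe_decay, Real.coe_toNNReal t ht0, ← Real.exp_add, ← Real.exp_add]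
        apply Real.exp_le_exp.2
        push_cast
        nlinarith [mul_le_mul_of_nonneg_left hks hl.le, mul_le_mul_of_nonneg_left htsT hl.le,
          mul_le_mul_of_nonneg_left hst hl.le, mul_pos hl hT0]
      have hNs0 : 0 ≤ N₀ := (abs_nonneg _).trans (le_max_right _ _)
      have hsa : Real.exp (-l * s) * N₀ ≤ a := by
        rw [ha]
        simp only [NNReal.coe_mul]
        exact mul_le_mul hexp hN₀le hNs0 (by positivity)
      have hNs' : max (V (ξ s k).x) |(ξ s k).η| ≤ a + b := by
        refine hNs.trans (add_le_add hsa ?_)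
        rw [hb, NNReal.coe_mul, hC, mul_comm ((_ : ℝ) + M)]
        gcongr
        linarith
      have hNt' : max (V (ξ t (k + 1)).x) |(ξ t (k + 1)).η| ≤ a + b := by
        refine hNt.trans ?_
        have h1 : Real.exp (-l * (t - s)) ≤ 1 := Real.exp_le_one_iff.2 (by nlinarith)
        have h2 : 0 ≤ Real.exp (-l * s) * N₀ +
            αw μ * (M / (1 - Real.exp (-l * tm))) := by positivity
        have h3 := mul_le_mul_of_nonneg_left hNs (Real.exp_pos (-l * (t - s))).le
        have h4 := mul_le_mul_of_nonneg_right h1 h2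
        have h5 : (b : ℝ) = αw μ * (M / (1 - Real.exp (-l * tm))) + αw μ * M := by
          rw [hb, NNReal.coe_mul, hC]; ring
        linarith
      have hx : ∀ r i, max (V (ξ r i).x) |(ξ r i).η| ≤ a + b → ‖(ξ r i).x‖₊ ≤ κ (a + b) := by
        intro r i hri
        apply hκle
        have := (hV (ξ r i).x).1.trans ((le_max_left _ _).trans hri)
        exact_mod_cast this
      have hη : ‖(ξ t (k + 1)).η‖₊ ≤ a + b := by
        rw [← NNReal.coe_le_coe, coe_nnnorm, Real.norm_eq_abs]
        exact_mod_cast (le_max_right _ _).trans hNt'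
      have hen : ‖(ξ t (k + 1)).e‖₊ ≤ κ (a + b) + κ (a + b) := by
        rw [he]
        exact (nnnorm_sub_le _ _).trans (add_le_add (hx _ _ hNs') (hx _ _ hNt'))
      calc (ξ t (k + 1)).size ≤ _ := State.size_le _
        _ ≤ κ (a + b) + (κ (a + b) + κ (a + b)) + (a + b) :=
          add_le_add (add_le_add (hx _ _ hNt') hen) hη
        _ = 3 * κ (a + b) + (a + b) := by ring
        _ ≤ 3 * (κ (2 * a) + κ (2 * b)) + (a + b) := by
          gcongr
          exact hκ.apply_add_le a b
        _ = ρ a + ρ b := by rw [hρdef]; ring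

variable {n : ℕ} {ε γ L : Fin (n + 1) → ℝ} {εref r₁ r₂ δ : ℝ}

theorem abs_iirS_le (hr₁ : 0 < r₁) (hr₂ : 0 < r₂) (hr : r₁ + r₂ ≤ 1) (hV : ∀ x, 0 ≤ V x)
    (x : Stacked np nc) (η : ℝ) :
    |iirS V δ εref r₁ r₂ ε γ L η x| ≤
      Real.exp (-εref * iirΓ V δ εref ε γ L x η) * max (V x) |η| := by
  have h0 : 0 ≤ max (V x) |η| := (hV x).trans (le_max_left _ _)
  unfold iirS
  rw [abs_mul, abs_of_pos (Real.exp_pos _)]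
  refine mul_le_mul_of_nonneg_left ?_ (Real.exp_pos _).le
  calc |r₁ * η + r₂ * V x| ≤ |r₁ * η| + |r₂ * V x| := abs_add_le _ _
    _ = r₁ * |η| + r₂ * V x := by
      rw [abs_mul, abs_mul, abs_of_pos hr₁, abs_of_pos hr₂, abs_of_nonneg (hV x)]
    _ ≤ r₁ * max (V x) |η| + r₂ * max (V x) |η| := by
      gcongr
      · exact le_max_right _ _
      · exact le_max_left _ _
    _ = (r₁ + r₂) * max (V x) |η| := by ring
    _ ≤ 1 * max (V x) |η| := by gcongr
    _ = _ := one_mul _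

/-- Any bound uniform in `(x, η)` will do; a sum replaces the maximum. -/
theorem iirΓ_le (hγ : ∀ i, 0 < γ i) (hδ : δ ∈ Ioo (0 : ℝ) 1) (x : Stacked np nc) (η : ℝ) :
    iirΓ V δ εref ε γ L x η ≤ |tmin δ (ε 0) (γ 0) (L 0)| +
      ∑ i : Fin n, δ * Tmax (γ i.succ) (max (L i.succ + ε i.succ / 2) (1 - δ)) := by
  have hpos : ∀ i : Fin n, 0 ≤ δ * Tmax (γ i.succ) (max (L i.succ + ε i.succ / 2) (1 - δ)) :=
    fun i => mul_nonneg hδ.1.le (Tmax_pos (hγ _) (lt_max_of_lt_right (sub_pos.2 hδ.2))).le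
  rcases (sampling_cases δ εref ε γ L (V x) η).2 with h | ⟨i, h, -⟩
  · rw [iirΓ, h]
    exact (le_abs_self _).trans (le_add_of_nonneg_right (Finset.sum_nonneg fun i _ => hpos i))
  · rw [iirΓ, h]
    refine (candidate_le (hγ _) hδ _ _).trans ((Finset.single_le_sum
      (f := fun i : Fin n => δ * Tmax (γ i.succ) (max (L i.succ + ε i.succ / 2) (1 - δ)))
      (fun i _ => hpos i) (Finset.mem_univ i)).trans (le_add_of_nonneg_left (abs_nonneg _)))

theorem stepDecay_iir
    (hf : Continuous fun z : Stacked np nc × Stacked np nc × Vec nw => P.f z.1 z.2.1 z.2.2)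
    (hLyap : ∀ i, HybridLyapunov P V αw (ε i) (γ i) (L i)) (hε : 0 < ε 0)
    (hr₁ : 0 < r₁) (hr₂ : 0 < r₂) (hr : r₁ + r₂ ≤ 1) (hεref : 0 < εref)
    (hδ : δ ∈ Ioo (0 : ℝ) 1) {T E : ℝ} (hT : ∀ x η, iirΓ V δ εref ε γ L x η ≤ T)
    (hE : ∀ i, |ε i| ≤ E) :
    StepDecay P (iirΓ V δ εref ε γ L) (iirS V δ εref r₁ r₂ ε γ L) V αw (min (ε 0) εref)
      (Real.exp (2 * E * T) * T) := by
  intro w dom ξ μ hξ hw t₀ t j htt h0 h1 ht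
  have hV0 := (hLyap 0).2.2.2.1
  have hΛ₀ : 0 < L 0 + ε 0 / 2 := by linarith [(hLyap 0).2.1]
  have hγ : ∀ i, 0 < γ i := fun i => (hLyap i).1
  obtain ⟨hx0, he0, -, hη, hτ, hτm⟩ := components_after_jump hξ htt h0 h1 ht
  set x₀ := (ξ t₀ j).x
  set η₀ := (ξ t₀ j).η
  set G := iirΓ V δ εref ε γ L x₀ η₀ with hG
  have htmin : 0 < tmin δ (ε 0) (γ 0) (L 0) := mul_pos hδ.1 (Tmax_pos (hγ 0) hΛ₀)
  have hGpos : 0 < G := htmin.trans_le (sampling_cases δ εref ε γ L (V x₀) η₀).1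
  have htG : t - t₀ ≤ G := by
    rcases htt.eq_or_lt with rfl | hlt
    · rw [sub_self]; exact hGpos.le
    · rw [← hτ, ← hτm]; exact τ_le_τmax hξ hlt h1 ht
  refine ⟨htG, ?_⟩
  have hs0 : 0 ≤ t - t₀ := sub_nonneg.2 htt
  have hsT : t - t₀ ≤ T := htG.trans (hT _ _)
  have hN0 : 0 ≤ max (V x₀) |η₀| := (hV0 x₀).trans (le_max_left _ _)
  have hA0 : (0 : ℝ) ≤ αw μ * (Real.exp (2 * E * T) * T) := by
    have := hs0.trans hsT
    positivity
  -- the estimate of one flow interval for a parameter set whose bound is respected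
  obtain ⟨hxac, heac, -⟩ := absolutelyContinuous_components (hξ.absCont (j + 1) t₀ h1 t ht)
  have hode := hξ.ae_hasDerivAt h1 ht
  have hflow : ∀ i Λ, 0 < Λ → L i + ε i / 2 ≤ Λ → G ≤ δ * Tmax (γ i) Λ →
      V (ξ t (j + 1)).x ≤ Real.exp (-ε i * (t - t₀)) * V x₀ +
        αw μ * (Real.exp (2 * E * T) * T) := by
    intro i Λ hΛ hLΛ hGΛ
    have h2 := (hLyap i).le_of_flow hf hΛ hLΛ hδ htt (htG.trans hGΛ) hxac heac (w := w) (μ := μ)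
      (by
        filter_upwards [hode, hw] with u hu hwu hm
        obtain ⟨h3, h4, -⟩ := hasDerivAt_components (hu hm).2
        exact ⟨h3, h4, hwu ((hξ.domain.1 _ h0).trans hm.1.le)⟩) he0
    rw [hx0] at h2
    refine h2.trans ?_
    rw [mul_add]
    refine add_le_add le_rfl ?_
    have hE0 := hE i
    have h5 : Real.exp (-ε i * (t - t₀)) * Real.exp (|ε i| * (t - t₀)) ≤
        Real.exp (2 * E * T) := by
      rw [← Real.exp_add]
      apply Real.exp_le_exp.2
      have h6 : -ε i * (t - t₀) ≤ |ε i| * (t - t₀) :=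
        mul_le_mul_of_nonneg_right (neg_le_abs _) hs0
      have h7 : |ε i| * (t - t₀) ≤ E * T :=
        mul_le_mul hE0 hsT hs0 ((abs_nonneg _).trans hE0)
      linarith
    calc _ = αw μ * ((Real.exp (-ε i * (t - t₀)) * Real.exp (|ε i| * (t - t₀))) * (t - t₀)) := by
          ring
      _ ≤ _ := by gcongr
  have hrate : ∀ c, min (ε 0) εref ≤ c →
      Real.exp (-c * (t - t₀)) ≤ Real.exp (-min (ε 0) εref * (t - t₀)) := fun c hc =>
    Real.exp_le_exp.2 (mul_le_mul_of_nonneg_right (neg_le_neg hc) hs0)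
  apply max_le
  · rcases (sampling_cases δ εref ε γ L (V x₀) η₀).2 with hc | ⟨i, hc, hlt⟩
    · refine (hflow 0 _ hΛ₀ le_rfl (le_of_eq hc)).trans (add_le_add ?_ le_rfl)
      exact mul_le_mul (hrate _ (min_le_left _ _)) (le_max_left _ _) (hV0 _) (Real.exp_pos _).le
    · have hGc : G ≤ candidate δ εref (ε i.succ) (γ i.succ) (L i.succ) (V x₀) η₀ := le_of_eq hc
      refine (hflow i.succ _ (lt_max_of_lt_right (sub_pos.2 hδ.2)) (le_max_left _ (1 - δ))
        (hGc.trans (candidate_le (hγ _) hδ _ _))).trans (add_le_add ?_ le_rfl)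
      -- The rate `ε i.succ` may be negative; decay is obtained against `η₀` instead, at rate
      -- `ε_ref`.
      refine (exp_mul_le_of_le_candidate (hV0 _) (htmin.trans hlt) hs0 (htG.trans hGc)).trans ?_
      refine (mul_le_mul_of_nonneg_left ((le_abs_self η₀).trans (le_max_right (V x₀) _))
        (Real.exp_pos _).le).trans ?_
      exact mul_le_mul_of_nonneg_right (hrate _ (min_le_right _ _)) hN0
  · rw [hη]
    refine (abs_iirS_le hr₁ hr₂ hr hV0 x₀ η₀).trans (le_add_of_le_of_nonneg ?_ hA0)
    refine mul_le_mul_of_nonneg_right ?_ hN0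
    -- The update already contains the decay over the whole interval `Γ ≥ t - t₀`, so `η` can stay
    -- constant during the flow.
    refine le_trans (Real.exp_le_exp.2 ?_) (hrate _ (min_le_right _ _))
    exact mul_le_mul_of_nonpos_left htG (by linarith)

end Stability

end STC

end

theorem theorem2 {np nc nu nw n : ℕ} (P : STC.Loop np nc nu nw)
    (hf : Continuous fun z : STC.Stacked np nc × STC.Stacked np nc × STC.Vec nw =>
      P.f z.1 z.2.1 z.2.2)
    (V : STC.Stacked np nc → ℝ) (αw : NNReal → NNReal) (ε γ L : Fin (n + 1) → ℝ)
    (hLyap : ∀ i, STC.HybridLyapunov P V αw (ε i) (γ i) (L i))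
    (hε : 0 < ε 0) (r₁ r₂ : ℝ) (hr₁ : 0 < r₁) (hr₂ : 0 < r₂) (hr : r₁ + r₂ ≤ 1)
    (εref : ℝ) (hεref : 0 < εref) (δ : ℝ) (hδ : δ ∈ Set.Ioo (0 : ℝ) 1) :
    0 < STC.tmin δ (ε 0) (γ 0) (L 0) ∧
    STC.InterSamplingAtLeast
      (STC.closedLoop P (STC.iirΓ V δ εref ε γ L) (STC.iirS V δ εref r₁ r₂ ε γ L))
      (STC.tmin δ (ε 0) (γ 0) (L 0)) ∧
    STC.IsISS
      (STC.closedLoop P (STC.iirΓ V δ εref ε γ L) (STC.iirS V δ εref r₁ r₂ ε γ L)) := by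
  have hγ : ∀ i, 0 < γ i := fun i => (hLyap i).1
  have htmin : 0 < STC.tmin δ (ε 0) (γ 0) (L 0) :=
    mul_pos hδ.1 (STC.Tmax_pos (hγ 0) (by linarith [(hLyap 0).2.1]))
  have hΓ : ∀ x η, STC.tmin δ (ε 0) (γ 0) (L 0) ≤ STC.iirΓ V δ εref ε γ L x η :=
    fun x η => (STC.sampling_cases δ εref ε γ L (V x) η).1
  refine ⟨htmin, ?_, ?_⟩
  · intro w dom ξ hξ _ j t t' ht ht'
    rw [STC.sub_eq_of_jumps hξ ht.1 ht.2 ht'.1 ht'.2]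
    exact hΓ _ _
  · have hT := STC.iirΓ_le (V := V) (εref := εref) (ε := ε) (L := L) hγ hδ
    have hE : ∀ i, |ε i| ≤ ∑ k, |ε k| := fun i =>
      Finset.single_le_sum (f := fun k => |ε k|) (fun k _ => abs_nonneg _) (Finset.mem_univ i)
    have hstep := STC.stepDecay_iir hf hLyap hε hr₁ hr₂ hr hεref hδ hT hE
    obtain ⟨-, -, -, -, hαw, -, -, -, -, αlo, αhi, -, -, -, -, -, -, hlo, hhi, -, hVb, -, -⟩ :=
      hLyap 0
    exact hstep.isISS (lt_min hε hεref)
      (mul_pos (Real.exp_pos _) (htmin.trans_le ((hΓ 0 0).trans (hT 0 0)))) htmin hΓ hT hαw hlo hhi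
      hVb
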